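/- **Theorem 3.5.** Let $d\ge 1$ and let $\mathbb{L}^d$ be the $d$-dimensional hypercubic lattice (vertex set $\mathbb{Z}^d$, with edges between vertices at $\ell^1$-distance $1$). A *positive walk of length $n$* is a self-avoiding walk with $n$ steps in $\mathbb{L}^d$ that starts at the origin and whose vertices $\vec u$ all satisfy $u_d\ge 0$. A *visit* is a vertex of the walk, other than its starting vertex, with $u_d=0$. Let $c_n^+(v)$ be the number of positive walks of length $n$ with exactly $v$ visits, and for $a>0$ put $$A_n^+(a)=\sum_{v=0}^n c_n^+(v)\,a^v,\qquad G_N(a,t)=\sum_{n=0}^N A_n^+(a)\,t^n .$$ For fixed $a>0$ regard $G_N(a,t)$ as a polynomial in $t\in\mathbb{C}$, and let $\alpha_N(\theta,\phi)$ be the number of its zeros $t_k$, counted with multiplicity, whose principal argument $\operatorname{Arg} t_k\in(-\pi,\pi]$ satisfies $\theta<\operatorname{Arg} t_k\le\phi$. Then the principal arguments of the zeros become uniformly distributed as $N\to\infty$: for every $d \ge 1$, every $a>0$ and all $-\pi\le\theta<\phi\le\pi$, $$\lim_{N\to\infty}\frac1N\,\alpha_N(\theta,\phi)=\frac{\phi-\theta}{2\pi}.$$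 -/

import Mathlib

open Filter Topology Polynomial

noncomputable section

namespace AdsorbingWalk

/-- The vertices of the `(d + 1)`-dimensional hypercubic lattice. The boundary hyperplane of the
half-lattice is the set of vertices whose last coordinate vanishes, a `d`-dimensional lattice. -/
abbrev Site (d : ℕ) : Type := Fin (d + 1) → ℤ

/-- The last coordinate of a vertex. -/
def Site.height {d : ℕ} (u : Site d) : ℤ := u (Fin.last d)

/-- Two vertices are joined by a lattice edge if their `ℓ¹`-distance is one. -/
def Site.Adj {d : ℕ} (u v : Site d) : Prop := ∑ i, |u i - v i| = 1

/-- `ω` is a positive walk of length `n`: a self-avoiding walk with `n` steps which starts at the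
origin and stays in the half-lattice of vertices with nonnegative last coordinate. -/
structure IsPositiveWalk {d n : ℕ} (ω : Fin (n + 1) → Site d) : Prop where
  start : ω 0 = 0
  step : ∀ i : Fin n, (ω i.castSucc).Adj (ω i.succ)
  selfAvoiding : Function.Injective ω
  nonneg : ∀ i, 0 ≤ (ω i).height

/-- The number of visits: vertices of the walk in the boundary hyperplane, not counting the
starting vertex. -/
def visits {d n : ℕ} (ω : Fin (n + 1) → Site d) : ℕ :=
  (Finset.univ.filter fun i : Fin (n + 1) => i ≠ 0 ∧ (ω i).height = 0).card

/-- There are finitely many positive walks of each length, so that counting them by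
`Set.ncard` is meaningful. -/
theorem finite_positiveWalks (d n : ℕ) :
    {ω : Fin (n + 1) → Site d | IsPositiveWalk ω}.Finite := by
  have key : ∀ ω : Fin (n + 1) → Site d, IsPositiveWalk ω →
      ∀ (i : Fin (n + 1)) (j : Fin (d + 1)), |ω i j| ≤ (i : ℕ) := by
    intro ω h i
    induction i using Fin.induction with
    | zero => intro j; simp [h.start]
    | succ i ih =>
      intro j
      have h1 : |ω i.castSucc j - ω i.succ j| ≤ 1 := by
        have h2 : ∑ k, |ω i.castSucc k - ω i.succ k| = 1 := h.step i
        rw [← h2]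
        exact Finset.single_le_sum (f := fun k => |ω i.castSucc k - ω i.succ k|)
          (fun k _ => abs_nonneg _) (Finset.mem_univ j)
      have h3 := ih j
      simp only [Fin.val_castSucc] at h3
      simp only [Fin.val_succ]
      push_cast
      rw [abs_le] at *
      constructor <;> linarith [h1.1, h1.2, h3.1, h3.2]
  refine Set.Finite.subset (Set.Finite.pi' fun _ : Fin (n + 1) =>
    Set.Finite.pi' fun _ : Fin (d + 1) => Set.finite_Icc (-(n : ℤ)) n) ?_
  intro ω h i j
  have h1 := key ω h i j
  have h2 : ((i : ℕ) : ℤ) ≤ n := by exact_mod_cast Nat.lt_succ_iff.mp i.isLt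
  exact ⟨by linarith [(abs_le.mp h1).1], by linarith [(abs_le.mp h1).2]⟩

/-- `c_n⁺(v)`: the number of positive walks of length `n` with exactly `v` visits. -/
def walkCount (d n v : ℕ) : ℕ :=
  {ω : Fin (n + 1) → Site d | IsPositiveWalk ω ∧ visits ω = v}.ncard

/-- The partition function `A_n⁺(a) = ∑_{v=0}^n c_n⁺(v) a^v`. -/
def partitionFunction (d n : ℕ) (a : ℝ) : ℝ :=
  ∑ v ∈ Finset.range (n + 1), (walkCount d n v : ℝ) * a ^ v

/-- The partial generating function `G_N(a, t) = ∑_{n=0}^N A_n⁺(a) t^n`, as a polynomial in `t`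
with complex coefficients. -/
def partialGF (d N : ℕ) (a : ℝ) : ℂ[X] :=
  ∑ n ∈ Finset.range (N + 1), C (partitionFunction d n a : ℂ) * X ^ n

/-- `α(θ, φ)` for a polynomial `P`: the number of complex zeros of `P`, counted with multiplicity,
whose principal argument (in `(-π, π]`) lies in `(θ, φ]`. -/
def angularCount (P : ℂ[X]) (θ φ : ℝ) : ℕ :=
  P.roots.countP fun z => θ < z.arg ∧ z.arg ≤ φ

end AdsorbingWalk

end

/-!
The proof combines two facts: the limit of `log A_n / n` exists, and for partial sums of a power
series with positive coefficients this alone forces the arguments of the zeros to be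
equidistributed.

*Existence of the limit.* In dimension one there is a single positive walk of each length. In
higher dimension, coordinate `0` is parallel to the boundary hyperplane, so that reflecting a part
of a walk in a hyperplane orthogonal to it keeps all heights and thus all visits. By the
Hammersley–Welsh unfolding (`exists_unfolds_of_cut`), a walk with `n` steps is brought by at most
about `√(2n)` such reflections into a form in which coordinate `0` is largest at the end. As each
reflection is determined by a time, this loses only a factor `exp (o(n))`
(`weight_le_weight_endMax`). Two walks of this form that end at the same height can be glued, the
second one run backwards, to a loop that starts and ends in the boundary hyperplane. Unfolding the
loop at both ends gives `A_n² ≤ exp (o(n)) L_{2n+1}`, where `L_n` is the total weight of the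
unfolded loops, the starting vertex contributing a factor `a` (`sq_weight_le`). Unfolded loops can
be concatenated, so `L_n` has an exponential growth rate by Fekete's lemma, and since
`L_n ≤ a A_n` the weights `A_n` have the same rate (`exists_tendsto_log_partitionFunction`).

*Equidistribution.* Let `c n` be the coefficients and `r` the inverse of their growth rate. By
Schur's inequality (`mul_norm_sub_sq_le`) the monic polynomial `Q` whose zeros `ζ i` are the
directions of the zeros of the partial sum satisfies `|Q| ≤ (∑ c n r ^ n) / √(c 0 c N r ^ N)`,
which is `exp (o(N))`, on the unit circle. The power sums of the `ζ i` are the coefficients of `log Q`, up to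
conjugation and elementary factors, and the Borel–Carathéodory theorem bounds them by the maximum
of `log |Q|` (`norm_sum_pow_le`). Hence they are `o(N)`, and Weyl's criterion applies
(`tendsto_card_of_fourier`).
-/

noncomputable section

namespace AdsorbingWalk

/-! ### Walks as functions on the natural numbers, and their weights -/

/-- A self-avoiding walk with `n` steps in the half-lattice, with an arbitrary starting vertex.
It is encoded as a function on `ℕ` which is constant from time `n` on, so that walks of different
lengths live in one type. -/
structure IsHalfWalk {d : ℕ} (n : ℕ) (ω : ℕ → Site d) : Prop where
  step : ∀ i < n, (ω i).Adj (ω (i + 1))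
  inj : ∀ i ≤ n, ∀ j ≤ n, ω i = ω j → i = j
  nonneg : ∀ i ≤ n, 0 ≤ (ω i).height
  eventuallyConst : ∀ i, n ≤ i → ω i = ω n

/-- The number of vertices of a walk in the boundary hyperplane, including the starting vertex. -/
def contacts {d : ℕ} (n : ℕ) (ω : ℕ → Site d) : ℕ :=
  ((Finset.range (n + 1)).filter fun i => (ω i).height = 0).card

/-- The extension to `ℕ` of a walk with `n` steps, constant from time `n` on. -/
def stopped {d n : ℕ} (w : Fin (n + 1) → Site d) (i : ℕ) : Site d :=
  w ⟨min i n, by omega⟩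

lemma stopped_val {d n : ℕ} (w : Fin (n + 1) → Site d) (i : Fin (n + 1)) : stopped w i = w i := by
  have := i.isLt
  unfold stopped
  congr 1
  ext
  simp only
  omega

lemma stopped_of_le {d n : ℕ} (w : Fin (n + 1) → Site d) {i : ℕ} (hi : i ≤ n) :
    stopped w i = w ⟨i, by omega⟩ :=
  stopped_val w ⟨i, by omega⟩

lemma stopped_injective {d n : ℕ} :
    Function.Injective (stopped : (Fin (n + 1) → Site d) → ℕ → Site d) := by
  intro w w' h
  ext1 i
  rw [← stopped_val w i, ← stopped_val w' i, h]

lemma IsPositiveWalk.stopped {d n : ℕ} {w : Fin (n + 1) → Site d} (h : IsPositiveWalk w) :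
    IsHalfWalk n (stopped w) where
  step i hi := by
    rw [stopped_of_le w hi.le, stopped_of_le w (Nat.succ_le_of_lt hi)]
    exact h.step ⟨i, hi⟩
  inj i hi j hj hij := by
    rw [stopped_of_le w hi, stopped_of_le w hj] at hij
    simpa using h.selfAvoiding hij
  nonneg i hi := h.nonneg _
  eventuallyConst i hi := by
    simp [AdsorbingWalk.stopped, hi]

lemma IsHalfWalk.exists_stopped {d n : ℕ} {ω : ℕ → Site d} (h : IsHalfWalk n ω) (h0 : ω 0 = 0) :
    ∃ w : Fin (n + 1) → Site d, IsPositiveWalk w ∧ stopped w = ω := by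
  refine ⟨fun i => ω i, ⟨h0, fun i => ?_, fun i j hij => ?_, fun i => ?_⟩, ?_⟩
  · simpa using h.step i i.isLt
  · exact Fin.ext (h.inj i (by omega) j (by omega) hij)
  · exact h.nonneg i (by omega)
  · ext1 i
    rcases le_total i n with hi | hi
    · rw [stopped_of_le _ hi]
    · simp [stopped, hi, h.eventuallyConst i hi]

lemma contacts_stopped {d n : ℕ} {w : Fin (n + 1) → Site d} (h0 : w 0 = 0) :
    contacts n (stopped w) = visits w + 1 := by
  have h1 : contacts n (stopped w) =
      (Finset.univ.filter fun i : Fin (n + 1) => (w i).height = 0).card := by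
    unfold contacts
    rw [Finset.card_filter, Finset.card_filter, Finset.sum_range]
    simp only [stopped_val]
  have h2 : (Finset.univ.filter fun i : Fin (n + 1) => (w i).height = 0) =
      insert 0 (Finset.univ.filter fun i : Fin (n + 1) => i ≠ 0 ∧ (w i).height = 0) := by
    ext i
    by_cases hi : i = 0
    · have h3 : (w 0).height = 0 := by rw [h0]; rfl
      simp [hi, h3]
    · simp [hi]
  rw [h1, h2, Finset.card_insert_of_notMem (by simp), visits]

lemma finite_walks (d n : ℕ) : {ω : ℕ → Site d | IsHalfWalk n ω ∧ ω 0 = 0}.Finite := by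
  refine ((finite_positiveWalks d n).image stopped).subset ?_
  rintro ω ⟨h, h0⟩
  obtain ⟨w, hw, rfl⟩ := h.exists_stopped h0
  exact ⟨w, hw, rfl⟩

/-- The positive walks with `n` steps, as functions on `ℕ`. -/
def walks (d n : ℕ) : Finset (ℕ → Site d) := (finite_walks d n).toFinset

lemma mem_walks {d n : ℕ} {ω : ℕ → Site d} : ω ∈ walks d n ↔ IsHalfWalk n ω ∧ ω 0 = 0 := by
  simp [walks]

open Classical in
/-- The total weight of the positive walks with `n` steps that have the property `T`. A walk is
weighted by `a` to the number of its vertices in the boundary hyperplane; the starting vertex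
counts, so that weights are multiplicative under concatenation. -/
def weight (d : ℕ) (a : ℝ) (n : ℕ) (T : (ℕ → Site d) → Prop) : ℝ :=
  ∑ ω ∈ (walks d n).filter T, a ^ contacts n ω

lemma walks_eq_image (d n : ℕ) :
    walks d n = (finite_positiveWalks d n).toFinset.map ⟨stopped, stopped_injective⟩ := by
  ext ω
  simp only [mem_walks, Finset.mem_map, Set.Finite.mem_toFinset, Set.mem_ofPred_eq,
    Function.Embedding.coeFn_mk]
  constructor
  · rintro ⟨h, h0⟩
    exact h.exists_stopped h0
  · rintro ⟨w, hw, rfl⟩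
    exact ⟨hw.stopped, (stopped_of_le w (Nat.zero_le n)).trans hw.start⟩

lemma visits_le {d n : ℕ} (w : Fin (n + 1) → Site d) : visits w ≤ n := by
  unfold visits
  calc _ ≤ (Finset.univ.erase (0 : Fin (n + 1))).card := by
        refine Finset.card_le_card fun i hi => ?_
        simp only [Finset.mem_filter] at hi
        simp [hi.2.1]
    _ = n := by simp

lemma partitionFunction_eq_sum (d n : ℕ) (a : ℝ) :
    partitionFunction d n a = ∑ w ∈ (finite_positiveWalks d n).toFinset, a ^ visits w := by
  have h1 : ∀ v, (walkCount d n v : ℝ) * a ^ v =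
      ∑ w ∈ (finite_positiveWalks d n).toFinset with visits w = v, a ^ visits w := by
    intro v
    rw [Finset.sum_congr rfl (g := fun _ => a ^ v)
      (fun w hw => by rw [(Finset.mem_filter.mp hw).2]), Finset.sum_const, nsmul_eq_mul]
    congr 2
    rw [walkCount, ← Set.ncard_coe_finset]
    congr 1
    ext w
    simp
  unfold partitionFunction
  simp_rw [h1]
  exact Finset.sum_fiberwise_of_maps_to
    (fun w _ => Finset.mem_range.mpr (Nat.lt_succ_of_le (visits_le w))) _

lemma weight_true (d n : ℕ) (a : ℝ) :
    weight d a n (fun _ => True) = a * partitionFunction d n a := by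
  rw [partitionFunction_eq_sum, weight, Finset.filter_true, walks_eq_image, Finset.sum_map,
    Finset.mul_sum]
  refine Finset.sum_congr rfl fun w hw => ?_
  have hw : IsPositiveWalk w := by simpa using hw
  simp only [Function.Embedding.coeFn_mk]
  rw [contacts_stopped hw.start, pow_succ']

lemma weight_nonneg {d : ℕ} {a : ℝ} (ha : 0 < a) (n : ℕ) (T : (ℕ → Site d) → Prop) :
    0 ≤ weight d a n T :=
  Finset.sum_nonneg fun _ _ => by positivity

/-- A property of walks is carried into another one by an injection that keeps contacts. -/
lemma weight_le_of_injOn {d : ℕ} {a : ℝ} (ha : 0 < a) {n m : ℕ} {T S : (ℕ → Site d) → Prop}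
    (f : (ℕ → Site d) → ℕ → Site d)
    (hf : ∀ ω ∈ walks d n, T ω → f ω ∈ walks d m ∧ S (f ω) ∧ contacts m (f ω) = contacts n ω)
    (hinj : Set.InjOn f {ω | ω ∈ walks d n ∧ T ω}) :
    weight d a n T ≤ weight d a m S := by
  classical
  unfold weight
  calc ∑ ω ∈ (walks d n).filter T, a ^ contacts n ω
      = ∑ ω ∈ (walks d n).filter T, a ^ contacts m (f ω) := by
        refine Finset.sum_congr rfl fun ω hω => ?_
        rw [Finset.mem_filter] at hω
        rw [(hf ω hω.1 hω.2).2.2]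
    _ = ∑ ω ∈ ((walks d n).filter T).image f, a ^ contacts m ω := by
        rw [Finset.sum_image]
        intro x hx y hy hxy
        exact hinj (by simpa using hx) (by simpa using hy) hxy
    _ ≤ _ := by
        refine Finset.sum_le_sum_of_subset_of_nonneg ?_ fun _ _ _ => by positivity
        intro y hy
        obtain ⟨ω, hω, rfl⟩ := Finset.mem_image.mp hy
        rw [Finset.mem_filter] at hω ⊢
        exact ⟨(hf ω hω.1 hω.2).1, (hf ω hω.1 hω.2).2.1⟩

lemma weight_mono {d : ℕ} {a : ℝ} (ha : 0 < a) (n : ℕ) {T S : (ℕ → Site d) → Prop}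
    (h : ∀ ω ∈ walks d n, T ω → S ω) : weight d a n T ≤ weight d a n S :=
  weight_le_of_injOn ha id (fun ω hω hT => ⟨hω, h ω hω hT, rfl⟩) Function.injective_id.injOn

/-! ### Reflections and the unfolding of walks -/

/-- The reflection of a vertex in the hyperplane where coordinate `0` equals `M`. -/
def reflect {d : ℕ} (M : ℤ) (u : Site d) : Site d := Function.update u 0 (2 * M - u 0)

@[simp] lemma reflect_zero {d : ℕ} (M : ℤ) (u : Site d) : reflect M u 0 = 2 * M - u 0 := by
  simp [reflect]

lemma reflect_of_ne {d : ℕ} (M : ℤ) (u : Site d) {j : Fin (d + 1)} (hj : j ≠ 0) :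
    reflect M u j = u j := by
  simp [reflect, hj]

@[simp] lemma reflect_reflect {d : ℕ} (M : ℤ) (u : Site d) : reflect M (reflect M u) = u := by
  ext1 j
  by_cases hj : j = 0
  · subst hj; simp
  · simp [reflect_of_ne, hj]

lemma reflect_eq_self {d : ℕ} {M : ℤ} {u : Site d} (h : u 0 = M) : reflect M u = u := by
  ext1 j
  by_cases hj : j = 0
  · subst hj; simp [h]; ring
  · simp [reflect_of_ne, hj]

lemma last_ne_zero {d : ℕ} [NeZero d] : Fin.last d ≠ 0 := by
  intro h
  exact NeZero.ne d (by simpa using congrArg Fin.val h)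

lemma height_reflect {d : ℕ} [NeZero d] (M : ℤ) (u : Site d) :
    (reflect M u).height = u.height :=
  reflect_of_ne M u last_ne_zero

lemma Site.Adj.reflect {d : ℕ} {u v : Site d} (h : u.Adj v) (M : ℤ) :
    Site.Adj (AdsorbingWalk.reflect M u) (AdsorbingWalk.reflect M v) := by
  unfold Site.Adj at *
  rw [← h]
  refine Finset.sum_congr rfl fun j _ => ?_
  by_cases hj : j = 0
  · subst hj
    rw [reflect_zero, reflect_zero, abs_sub_comm]
    congr 1
    ring
  · simp [reflect_of_ne, hj]

lemma Site.Adj.abs_sub_le {d : ℕ} {u v : Site d} (h : u.Adj v) (j : Fin (d + 1)) :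
    |u j - v j| ≤ 1 := by
  unfold Site.Adj at h
  rw [← h]
  exact Finset.single_le_sum (f := fun k => |u k - v k|) (fun k _ => abs_nonneg _)
    (Finset.mem_univ j)

/-- The part of the walk after time `c` is reflected in the hyperplane through the vertex visited
at time `c` that is orthogonal to the direction of coordinate `0`. -/
def flip {d : ℕ} (c : ℕ) (ω : ℕ → Site d) (i : ℕ) : Site d :=
  if i ≤ c then ω i else reflect (ω c 0) (ω i)

lemma flip_of_le {d : ℕ} {c i : ℕ} (ω : ℕ → Site d) (h : i ≤ c) : flip c ω i = ω i := by
  simp [flip, h]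

lemma flip_of_ge {d : ℕ} {c i : ℕ} (ω : ℕ → Site d) (h : c ≤ i) :
    flip c ω i = reflect (ω c 0) (ω i) := by
  rcases h.eq_or_lt with rfl | h
  · simp [flip, reflect_eq_self]
  · simp [flip, h]

lemma flip_flip {d : ℕ} (c : ℕ) (ω : ℕ → Site d) : flip c (flip c ω) = ω := by
  ext1 i
  rcases le_total i c with h | h
  · rw [flip_of_le _ h, flip_of_le _ h]
  · rw [flip_of_ge _ h, flip_of_ge _ h, flip_of_le _ le_rfl, reflect_reflect]

lemma flip_injective {d : ℕ} (c : ℕ) :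
    Function.Injective (flip c : (ℕ → Site d) → ℕ → Site d) :=
  Function.LeftInverse.injective (flip_flip c)

lemma height_flip {d : ℕ} [NeZero d] (c : ℕ) (ω : ℕ → Site d) (i : ℕ) :
    (flip c ω i).height = (ω i).height := by
  unfold flip
  split_ifs
  · rfl
  · exact height_reflect _ _

lemma contacts_flip {d : ℕ} [NeZero d] (n c : ℕ) (ω : ℕ → Site d) :
    contacts n (flip c ω) = contacts n ω := by
  simp [contacts, height_flip]

/-- A flip at the last time at which coordinate `0` is maximal keeps a walk self-avoiding. -/
lemma IsHalfWalk.flip {d : ℕ} [NeZero d] {n c : ℕ} {ω : ℕ → Site d} (h : IsHalfWalk n ω)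
    (hc : c ≤ n) (hle : ∀ i ≤ c, ω i 0 ≤ ω c 0) (hlt : ∀ i, c < i → i ≤ n → ω i 0 < ω c 0) :
    IsHalfWalk n (flip c ω) where
  step i hi := by
    rcases lt_or_ge i c with hic | hic
    · rw [flip_of_le _ hic.le, flip_of_le _ (Nat.succ_le_of_lt hic)]
      exact h.step i hi
    · rw [flip_of_ge _ hic, flip_of_ge _ (Nat.le_succ_of_le hic)]
      exact (h.step i hi).reflect _
  inj i hi j hj hij := by
    rcases le_or_gt i c with hic | hic <;> rcases le_or_gt j c with hjc | hjc
    · rw [flip_of_le _ hic, flip_of_le _ hjc] at hij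
      exact h.inj i hi j hj hij
    · rw [flip_of_le _ hic, flip_of_ge _ hjc.le] at hij
      have := congrFun hij 0
      rw [reflect_zero] at this
      linarith [hle i hic, hlt j hjc hj]
    · rw [flip_of_ge _ hic.le, flip_of_le _ hjc] at hij
      have := congrFun hij 0
      rw [reflect_zero] at this
      linarith [hle j hjc, hlt i hic hi]
    · rw [flip_of_ge _ hic.le, flip_of_ge _ hjc.le] at hij
      refine h.inj i hi j hj ?_
      rw [← reflect_reflect (ω c 0) (ω i), hij, reflect_reflect]
  nonneg i hi := by
    rw [height_flip]
    exact h.nonneg i hi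
  eventuallyConst i hi := by
    rw [flip_of_ge _ (hc.trans hi), flip_of_ge _ hc, h.eventuallyConst i hi]

/-- The last vertex of the walk has the largest coordinate `0`. -/
def EndMax {d : ℕ} (n : ℕ) (ω : ℕ → Site d) : Prop := ∀ i ≤ n, ω i 0 ≤ ω n 0

/-- The first vertex of the walk has the smallest coordinate `0`. -/
def StartMin {d : ℕ} (n : ℕ) (ω : ℕ → Site d) : Prop := ∀ i ≤ n, ω 0 0 ≤ ω i 0

/-- `j` flips at suitable times turn the positive walk `ω` into one whose last vertex has the
largest coordinate `0` and which has the property `T`. -/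
def Unfolds {d : ℕ} (n : ℕ) (T : (ℕ → Site d) → Prop) : ℕ → (ℕ → Site d) → Prop
  | 0, ω => ω ∈ walks d n ∧ T ω ∧ EndMax n ω
  | j + 1, ω => ω ∈ walks d n ∧ ∃ c ≤ n, Unfolds n T j (flip c ω)

lemma Unfolds.mem_walks {d n : ℕ} {T : (ℕ → Site d) → Prop} {j : ℕ} {ω : ℕ → Site d}
    (h : Unfolds n T j ω) : ω ∈ walks d n := by
  cases j <;> exact h.1

lemma Unfolds.succ {d n : ℕ} {T : (ℕ → Site d) → Prop} {j : ℕ} {ω : ℕ → Site d}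
    (h : Unfolds n T j ω) : Unfolds n T (j + 1) ω := by
  refine ⟨h.mem_walks, n, le_rfl, ?_⟩
  have h1 : flip n ω = ω := by
    ext1 i
    rcases le_total i n with hi | hi
    · rw [flip_of_le _ hi]
    · have := (AdsorbingWalk.mem_walks.mp h.mem_walks).1.eventuallyConst i hi
      rw [flip_of_ge _ hi, this, reflect_eq_self rfl]
  rwa [h1]

lemma Unfolds.mono {d n : ℕ} {T : (ℕ → Site d) → Prop} {j k : ℕ} {ω : ℕ → Site d}
    (h : Unfolds n T j ω) (hjk : j ≤ k) : Unfolds n T k ω := by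
  induction k, hjk using Nat.le_induction with
  | base => exact h
  | succ k _ ih => exact ih.succ

/-- Each flip costs a factor `n + 1`, the number of times at which it may take place: for a given
time the flip is an injection that keeps contacts. -/
lemma weight_unfolds_le {d : ℕ} [NeZero d] {a : ℝ} (ha : 0 < a) (n : ℕ)
    (T : (ℕ → Site d) → Prop) (j : ℕ) :
    weight d a n (Unfolds n T j) ≤ (n + 1 : ℝ) ^ j * weight d a n fun ω => T ω ∧ EndMax n ω := by
  classical
  induction j with
  | zero => simpa using weight_mono ha n fun ω _ h => h.2
  | succ j ih =>
    have h1 : weight d a n (Unfolds n T (j + 1)) ≤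
        ∑ c ∈ Finset.range (n + 1), weight d a n fun ω => Unfolds n T j (flip c ω) := by
      simp only [weight, Finset.sum_filter]
      rw [Finset.sum_comm]
      refine Finset.sum_le_sum fun ω _ => ?_
      have h2 : ∀ c ∈ Finset.range (n + 1),
          0 ≤ if Unfolds n T j (flip c ω) then a ^ contacts n ω else 0 := fun c _ => by
        split_ifs <;> positivity
      split_ifs with h
      · obtain ⟨-, c, hc, hu⟩ := h
        have h3 := Finset.single_le_sum h2 (Finset.mem_range.mpr (Nat.lt_succ_of_le hc))
        rwa [if_pos hu] at h3
      · exact Finset.sum_nonneg h2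
    calc _ ≤ _ := h1
      _ ≤ ∑ c ∈ Finset.range (n + 1), weight d a n (Unfolds n T j) :=
          Finset.sum_le_sum fun c _ => weight_le_of_injOn ha (flip c)
            (fun ω _ hu => ⟨hu.mem_walks, hu, contacts_flip n c ω⟩) (flip_injective c).injOn
      _ = (n + 1 : ℝ) * weight d a n (Unfolds n T j) := by simp
      _ ≤ (n + 1 : ℝ) * ((n + 1 : ℝ) ^ j * weight d a n fun ω => T ω ∧ EndMax n ω) := by gcongr
      _ = _ := by ring

lemma exists_last_max (x : ℕ → ℤ) (n : ℕ) :
    ∃ m ≤ n, (∀ i ≤ n, x i ≤ x m) ∧ ∀ i, m < i → i ≤ n → x i < x m := by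
  induction n with
  | zero => exact ⟨0, le_rfl, by simp, by intro i; omega⟩
  | succ n ih =>
    obtain ⟨m, hm, h1, h2⟩ := ih
    rcases lt_or_ge (x (n + 1)) (x m) with h | h
    · refine ⟨m, by omega, fun i hi => ?_, fun i hmi hi => ?_⟩ <;>
        rcases Nat.le_succ_iff.mp hi with hi | rfl
      exacts [h1 i hi, h.le, h2 i hmi hi, h]
    · refine ⟨n + 1, le_rfl, fun i hi => ?_, fun i => by omega⟩
      rcases Nat.le_succ_iff.mp hi with hi | rfl
      exacts [(h1 i hi).trans h, le_rfl]

lemma IsHalfWalk.sub_le {d : ℕ} {n : ℕ} {ω : ℕ → Site d} (h : IsHalfWalk n ω) (j : Fin (d + 1))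
    {p m : ℕ} (hpm : p ≤ m) (hm : m ≤ n) : ω m j - ω p j ≤ m - p := by
  induction m, hpm using Nat.le_induction with
  | base => simp
  | succ m hpm ih =>
    have h1 := abs_le.mp ((h.step m (by omega)).abs_sub_le j)
    have h2 := ih (by omega)
    push_cast
    linarith [h1.1]

/-- The property `T` survives flips at times at which coordinate `0` is maximal. -/
def FlipStable {d : ℕ} (n : ℕ) (T : (ℕ → Site d) → Prop) : Prop :=
  ∀ ω c, c ≤ n → (∀ i ≤ n, ω i 0 ≤ ω c 0) → T ω → T (flip c ω)

/-- The Hammersley–Welsh unfolding. Suppose that the walk stays weakly to the left of its vertex at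
time `p` before `p`, and strictly to the right afterwards, by at most `s`. The flips at successive
last maxima leave parts whose widths strictly decrease. As a part has at least as many steps as its
width, the number `j` of flips satisfies `1 + 2 + ⋯ + j ≤ n - p`. -/
lemma exists_unfolds_of_cut {d : ℕ} [NeZero d] {n : ℕ} {T : (ℕ → Site d) → Prop}
    (hT : FlipStable n T) (s : ℕ) : ∀ (ω : ℕ → Site d) (p : ℕ), ω ∈ walks d n → T ω → p ≤ n →
    (∀ i ≤ p, ω i 0 ≤ ω p 0) → (∀ i, p < i → i ≤ n → ω p 0 < ω i 0) →
    (∀ i ≤ n, ω i 0 - ω p 0 ≤ s) →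
    ∃ j ≤ s, j * (j + 1) ≤ 2 * (n - p) ∧ Unfolds n T j ω := by
  induction s using Nat.strong_induction_on with
  | _ s ih =>
  intro ω p hω hTω hp hl hr hs
  obtain ⟨m, hmn, hmax, hlast⟩ := exists_last_max (fun i => ω i 0) n
  rcases hmn.eq_or_lt with rfl | hmn'
  · exact ⟨0, by simp, by simp, hω, hTω, hmax⟩
  have hpm : p < m := by
    by_contra! hmp
    rcases hmp.eq_or_lt with rfl | hmp
    · exact absurd (hr n hmn' le_rfl) (not_lt.mpr (hmax n le_rfl))
    · exact absurd (hlast p hmp hp) (not_lt.mpr (hl m hmp.le))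
  have hw := (mem_walks.mp hω).1
  have hspan := hw.sub_le 0 hpm.le hmn
  have hpos := hr m hpm hmn
  obtain ⟨t, ht⟩ : ∃ t : ℕ, ω m 0 - ω p 0 = t + 1 :=
    ⟨(ω m 0 - ω p 0 - 1).toNat, by omega⟩
  have hsm := hs m hmn
  have hval : ∀ i, m ≤ i → flip m ω i 0 = 2 * ω m 0 - ω i 0 := fun i hi => by
    rw [flip_of_ge _ hi, reflect_zero]
  have hmm : flip m ω m = ω m := flip_of_le _ le_rfl
  obtain ⟨j, hj, hjn, hu⟩ := ih t (by omega) (flip m ω) m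
    (mem_walks.mpr ⟨hw.flip hmn (fun i hi => hmax i (hi.trans hmn)) hlast, by
      rw [flip_of_le _ (Nat.zero_le m)]; exact (mem_walks.mp hω).2⟩)
    (hT ω m hmn hmax hTω) hmn
    (fun i hi => by rw [flip_of_le _ hi, hmm]; exact hmax i (hi.trans hmn))
    (fun i hi hin => by rw [hval i hi.le, hmm]; linarith [hlast i hi hin])
    (fun i hi => by
      rcases le_or_gt i m with him | him
      · rw [flip_of_le _ him, hmm]; linarith [hmax i hi]
      · rw [hval i him.le, hmm]; linarith [hr i (hpm.trans him) hi])
  refine ⟨j + 1, by omega, ?_, hω, m, hmn, hu⟩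
  have h1 : j + 1 ≤ m - p := by omega
  have h2 : n - p = (n - m) + (m - p) := by omega
  rw [h2]
  nlinarith

/-- The number of flips that suffices to unfold any walk with `n` steps. -/
def unfoldBound (n : ℕ) : ℕ := Nat.sqrt (2 * n) + 1

lemma unfolds_unfoldBound {d : ℕ} [NeZero d] {n : ℕ} {T : (ℕ → Site d) → Prop}
    (hT : FlipStable n T) {ω : ℕ → Site d} (hω : ω ∈ walks d n) (hTω : T ω) :
    Unfolds n T (unfoldBound n) ω := by
  obtain ⟨m, hmn, hmax, hlast⟩ := exists_last_max (fun i => ω i 0) n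
  have hw := (mem_walks.mp hω).1
  have hval : ∀ i, m ≤ i → flip m ω i 0 = 2 * ω m 0 - ω i 0 := fun i hi => by
    rw [flip_of_ge _ hi, reflect_zero]
  have hmm : flip m ω m = ω m := flip_of_le _ le_rfl
  have hflip := hw.flip hmn (fun i hi => hmax i (hi.trans hmn)) hlast
  obtain ⟨j, -, hj, hu⟩ := exists_unfolds_of_cut hT n (flip m ω) m
    (mem_walks.mpr ⟨hflip, by
      rw [flip_of_le _ (Nat.zero_le m)]; exact (mem_walks.mp hω).2⟩)
    (hT ω m hmn hmax hTω) hmn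
    (fun i hi => by rw [flip_of_le _ hi, hmm]; exact hmax i (hi.trans hmn))
    (fun i hi hin => by rw [hval i hi.le, hmm]; linarith [hlast i hi hin])
    (fun i hi => by
      rcases le_or_gt i m with him | him
      · rw [flip_of_le _ him, hmm]; linarith [hmax i hi]
      · have := hflip.sub_le 0 him.le hi
        omega)
  refine Unfolds.mono (j := j + 1) ⟨hω, m, hmn, hu⟩ ?_
  unfold unfoldBound
  refine Nat.succ_le_succ (Nat.le_sqrt.mpr ?_)
  have : n - m ≤ n := Nat.sub_le n m
  nlinarith

/-- Unfolding a class of walks loses only a subexponential factor. -/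
theorem weight_le_weight_endMax {d : ℕ} [NeZero d] {a : ℝ} (ha : 0 < a) {n : ℕ}
    {T : (ℕ → Site d) → Prop} (hT : FlipStable n T) :
    weight d a n T ≤ (n + 1 : ℝ) ^ unfoldBound n * weight d a n fun ω => T ω ∧ EndMax n ω :=
  (weight_mono ha n fun _ hω h => unfolds_unfoldBound hT hω h).trans
    (weight_unfolds_le ha n T (unfoldBound n))

/-! ### Reversal and concatenation -/

/-- The walk `ω` run backwards. Heights are kept; the other coordinates are reflected in a point,
such that the new starting vertex has them equal to zero. -/
def rev {d : ℕ} (n : ℕ) (ω : ℕ → Site d) (i : ℕ) : Site d := fun j =>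
  if j = Fin.last d then ω (n - i) j else ω n j - ω (n - i) j

lemma rev_last {d : ℕ} (n : ℕ) (ω : ℕ → Site d) (i : ℕ) :
    rev n ω i (Fin.last d) = ω (n - i) (Fin.last d) := by simp [rev]

lemma rev_of_ne {d : ℕ} (n : ℕ) (ω : ℕ → Site d) (i : ℕ) {j : Fin (d + 1)}
    (hj : j ≠ Fin.last d) : rev n ω i j = ω n j - ω (n - i) j := by simp [rev, hj]

lemma height_rev {d : ℕ} (n : ℕ) (ω : ℕ → Site d) (i : ℕ) :
    (rev n ω i).height = (ω (n - i)).height := rev_last n ω i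

lemma contacts_rev {d : ℕ} (n : ℕ) (ω : ℕ → Site d) : contacts n (rev n ω) = contacts n ω := by
  unfold contacts
  rw [Finset.card_filter, Finset.card_filter, ← Finset.sum_range_reflect]
  refine Finset.sum_congr rfl fun i hi => ?_
  have : i ≤ n := by simpa [Nat.lt_succ_iff] using hi
  rw [height_rev, show n - (n + 1 - 1 - i) = i by omega]

lemma rev_rev {d n : ℕ} {ω : ℕ → Site d} (h : ∀ i, n ≤ i → ω i = ω n) (h0 : ω 0 = 0) :
    rev n (rev n ω) = ω := by
  ext i j
  have h1 : ω (n - (n - i)) = ω i := by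
    rcases le_total i n with hi | hi
    · rw [Nat.sub_sub_self hi]
    · rw [h i hi, Nat.sub_eq_zero_of_le hi, Nat.sub_zero]
  by_cases hj : j = Fin.last d
  · subst hj
    rw [rev_last, rev_last, h1]
  · rw [rev_of_ne _ _ _ hj, rev_of_ne _ _ _ hj, rev_of_ne _ _ _ hj, h1, Nat.sub_self, h0]
    simp

lemma rev_injOn {d n : ℕ} {T : (ℕ → Site d) → Prop} :
    Set.InjOn (rev n) {ω | ω ∈ walks d n ∧ T ω} := by
  intro ω hω ω' hω' h
  obtain ⟨hw, h0⟩ := mem_walks.mp hω.1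
  obtain ⟨hw', h0'⟩ := mem_walks.mp hω'.1
  rw [← rev_rev hw.eventuallyConst h0, h, rev_rev hw'.eventuallyConst h0']

lemma Site.Adj.symm {d : ℕ} {u v : Site d} (h : u.Adj v) : v.Adj u := by
  unfold Site.Adj at *
  simpa only [abs_sub_comm] using h

lemma IsHalfWalk.rev {d n : ℕ} {ω : ℕ → Site d} (h : IsHalfWalk n ω) :
    IsHalfWalk n (rev n ω) where
  step i hi := by
    have h1 := (h.step (n - (i + 1)) (by omega)).symm
    rw [show n - (i + 1) + 1 = n - i by omega] at h1
    unfold Site.Adj at *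
    rw [← h1]
    refine Finset.sum_congr rfl fun j _ => ?_
    by_cases hj : j = Fin.last d
    · subst hj
      rw [rev_last, rev_last]
    · rw [rev_of_ne _ _ _ hj, rev_of_ne _ _ _ hj, abs_sub_comm]
      congr 1
      ring
  inj i hi j hj hij := by
    have h1 : ω (n - i) = ω (n - j) := by
      ext k
      have h2 := congrFun hij k
      by_cases hk : k = Fin.last d
      · subst hk
        simpa only [rev_last] using h2
      · rw [rev_of_ne _ _ _ hk, rev_of_ne _ _ _ hk] at h2
        linarith
    have := h.inj _ (Nat.sub_le n i) _ (Nat.sub_le n j) h1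
    omega
  nonneg i hi := by
    rw [height_rev]
    exact h.nonneg _ (Nat.sub_le n i)
  eventuallyConst i hi := by
    unfold AdsorbingWalk.rev
    rw [Nat.sub_eq_zero_of_le hi, Nat.sub_self]

/-- The walk `ω` with `n` steps, followed by a step in the direction of coordinate `0` and by the
walk `η`. The translation leaves heights alone, so `η` has to start at the height where `ω` ends. -/
def join {d : ℕ} (n : ℕ) (ω η : ℕ → Site d) (i : ℕ) : Site d :=
  if i ≤ n then ω i else fun j =>
    η (i - (n + 1)) j + if j = Fin.last d then 0 else ω n j + if j = 0 then 1 else 0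

lemma join_of_le {d n i : ℕ} (ω η : ℕ → Site d) (hi : i ≤ n) : join n ω η i = ω i := by
  simp [join, hi]

lemma join_add_last {d : ℕ} (n i : ℕ) (ω η : ℕ → Site d) :
    join n ω η (n + 1 + i) (Fin.last d) = η i (Fin.last d) := by
  simp [join, show ¬ n + 1 + i ≤ n by omega]

lemma join_add_zero {d : ℕ} [NeZero d] (n i : ℕ) (ω η : ℕ → Site d) :
    join n ω η (n + 1 + i) 0 = η i 0 + (ω n 0 + 1) := by
  simp [join, show ¬ n + 1 + i ≤ n by omega, last_ne_zero.symm]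

lemma join_add_of_ne {d : ℕ} (n i : ℕ) (ω η : ℕ → Site d) {j : Fin (d + 1)}
    (hj : j ≠ Fin.last d) :
    join n ω η (n + 1 + i) j = η i j + (ω n j + if j = 0 then 1 else 0) := by
  simp [join, show ¬ n + 1 + i ≤ n by omega, hj]

lemma join_injective {d n : ℕ} {ω η ω' η' : ℕ → Site d} (hω : ∀ i, n ≤ i → ω i = ω n)
    (hω' : ∀ i, n ≤ i → ω' i = ω' n) (h : join n ω η = join n ω' η') : ω = ω' ∧ η = η' := by
  have h1 : ∀ i ≤ n, ω i = ω' i := fun i hi => by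
    rw [← join_of_le ω η hi, h, join_of_le _ _ hi]
  refine ⟨?_, ?_⟩
  · ext1 i
    rcases le_total i n with hi | hi
    · exact h1 i hi
    · rw [hω i hi, hω' i hi, h1 n le_rfl]
  · ext i j
    have h2 := congrFun (congrFun h (n + 1 + i)) j
    by_cases hj : j = Fin.last d
    · subst hj
      simpa only [join_add_last] using h2
    · rw [join_add_of_ne _ _ _ _ hj, join_add_of_ne _ _ _ _ hj, h1 n le_rfl] at h2
      linarith

lemma contacts_join {d : ℕ} (n m : ℕ) (ω η : ℕ → Site d) :
    contacts (n + m + 1) (join n ω η) = contacts n ω + contacts m η := by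
  unfold contacts
  simp only [Finset.card_filter]
  rw [show n + m + 1 + 1 = (n + 1) + (m + 1) by ring, Finset.sum_range_add]
  congr 1
  · refine Finset.sum_congr rfl fun i hi => ?_
    rw [join_of_le _ _ (by simpa [Nat.lt_succ_iff] using hi)]
  · refine Finset.sum_congr rfl fun i _ => ?_
    have h : (join n ω η (n + 1 + i)).height = (η i).height := join_add_last n i ω η
    rw [h]

lemma isHalfWalk_join {d n m : ℕ} [NeZero d] {ω η : ℕ → Site d} (hω : IsHalfWalk n ω)
    (hη : IsHalfWalk m η) (hend : EndMax n ω) (hstart : ∀ i ≤ m, 0 ≤ η i 0)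
    (h0 : ∀ j, j ≠ Fin.last d → η 0 j = 0) (hh : (η 0).height = (ω n).height) :
    IsHalfWalk (n + m + 1) (join n ω η) := by
  have hsplit : ∀ i ≤ n + m + 1, i ≤ n ∨ ∃ k ≤ m, i = n + 1 + k := fun i hi => by
    rcases le_or_gt i n with h | h
    · exact Or.inl h
    · exact Or.inr ⟨i - (n + 1), by omega, by omega⟩
  have hsep : ∀ i ≤ n, ∀ k ≤ m, join n ω η i ≠ join n ω η (n + 1 + k) := by
    intro i hi k hk h
    have h1 := congrFun h 0
    rw [join_of_le _ _ hi, join_add_zero] at h1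
    linarith [hend i hi, hstart k hk]
  constructor
  · intro i hi
    rcases hsplit i hi.le with hin | ⟨k, hk, rfl⟩
    · rcases hin.eq_or_lt with rfl | hin
      · have h1 : ∀ j, |join i ω η i j - join i ω η (i + 1 + 0) j| = if j = 0 then 1 else 0 := by
          intro j
          rw [join_of_le _ _ le_rfl]
          by_cases hj : j = Fin.last d
          · subst hj
            have h2 : η 0 (Fin.last d) = ω i (Fin.last d) := hh
            rw [join_add_last, h2]
            simp [NeZero.ne d]
          · rw [join_add_of_ne _ _ _ _ hj, h0 j hj]
            split_ifs <;> simp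
        unfold Site.Adj
        rw [Finset.sum_congr rfl fun j _ => h1 j]
        simp
      · rw [join_of_le _ _ hin.le, join_of_le _ _ (Nat.succ_le_of_lt hin)]
        exact hω.step i hin
    · rw [add_assoc (n + 1) k 1]
      have h1 := hη.step k (by omega)
      unfold Site.Adj at *
      rw [← h1]
      refine Finset.sum_congr rfl fun j _ => ?_
      by_cases hj : j = Fin.last d
      · subst hj
        rw [join_add_last, join_add_last]
      · rw [join_add_of_ne _ _ _ _ hj, join_add_of_ne _ _ _ _ hj]
        congr 1
        ring
  · intro i hi j hj hij
    rcases hsplit i hi with hin | ⟨k, hk, rfl⟩ <;> rcases hsplit j hj with hjn | ⟨l, hl, rfl⟩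
    · rw [join_of_le _ _ hin, join_of_le _ _ hjn] at hij
      exact hω.inj i hin j hjn hij
    · exact absurd hij (hsep i hin l hl)
    · exact absurd hij.symm (hsep j hjn k hk)
    · have h1 : η k = η l := by
        ext c
        have h2 := congrFun hij c
        by_cases hc : c = Fin.last d
        · subst hc
          simpa only [join_add_last] using h2
        · rw [join_add_of_ne _ _ _ _ hc, join_add_of_ne _ _ _ _ hc] at h2
          linarith
      rw [hη.inj k hk l hl h1]
  · intro i hi
    rcases hsplit i hi with hin | ⟨k, hk, rfl⟩
    · rw [join_of_le _ _ hin]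
      exact hω.nonneg i hin
    · rw [Site.height, join_add_last]
      exact hη.nonneg k hk
  · intro i hi
    obtain ⟨k, hk, rfl⟩ : ∃ k, m ≤ k ∧ i = n + 1 + k := ⟨i - (n + 1), by omega, by omega⟩
    have h1 : ∀ l, join n ω η (n + 1 + l) = fun j => η l j +
        if j = Fin.last d then 0 else ω n j + if j = 0 then 1 else 0 := fun l => by
      simp [join, show ¬ n + 1 + l ≤ n by omega]
    rw [show n + m + 1 = n + 1 + m by ring, h1, h1, hη.eventuallyConst k hk]

/-- The walk ends in the boundary hyperplane. A positive walk with this property is a loop. -/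
def EndsLow {d : ℕ} (n : ℕ) (ω : ℕ → Site d) : Prop := (ω n).height = 0

/-- Loops whose coordinate `0` is smallest at the start and largest at the end. These are the ones
that can be concatenated. -/
def IsUnfoldedLoop {d : ℕ} (n : ℕ) (ω : ℕ → Site d) : Prop :=
  (EndsLow n ω ∧ StartMin n ω) ∧ EndMax n ω

/-- Pairs of walks inject into walks, contacts being additive. -/
lemma sum_product_le_weight {d n m k : ℕ} {a : ℝ} (ha : 0 < a) {T : (ℕ → Site d) → Prop}
    (s : Finset ((ℕ → Site d) × (ℕ → Site d))) (f : (ℕ → Site d) × (ℕ → Site d) → ℕ → Site d)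
    (hf : ∀ p ∈ s, f p ∈ walks d k ∧ T (f p) ∧
      contacts k (f p) = contacts n p.1 + contacts m p.2)
    (hinj : Set.InjOn f s) :
    ∑ p ∈ s, a ^ contacts n p.1 * a ^ contacts m p.2 ≤ weight d a k T := by
  classical
  calc _ = ∑ p ∈ s, a ^ contacts k (f p) := by
        refine Finset.sum_congr rfl fun p hp => ?_
        rw [(hf p hp).2.2, pow_add]
    _ = ∑ ω ∈ s.image f, a ^ contacts k ω := by
        rw [Finset.sum_image fun x hx y hy h => hinj hx hy h]
    _ ≤ _ := by
        refine Finset.sum_le_sum_of_subset_of_nonneg ?_ fun _ _ _ => by positivity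
        intro y hy
        obtain ⟨p, hp, rfl⟩ := Finset.mem_image.mp hy
        exact Finset.mem_filter.mpr ⟨(hf p hp).1, (hf p hp).2.1⟩

/-- Unfolded loops can be concatenated, with one connecting step in the boundary hyperplane. -/
theorem weight_unfoldedLoop_mul_le {d : ℕ} [NeZero d] {a : ℝ} (ha : 0 < a) (n m : ℕ) :
    weight d a n (IsUnfoldedLoop n) * weight d a m (IsUnfoldedLoop m) ≤
      weight d a (n + m + 1) (IsUnfoldedLoop (n + m + 1)) := by
  classical
  conv_lhs => rw [weight, weight, Finset.sum_mul_sum, ← Finset.sum_product']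
  refine sum_product_le_weight ha _ (fun p => join n p.1 p.2) ?_ ?_
  · rintro ⟨ω, η⟩ hp
    simp only [Finset.mem_product, Finset.mem_filter, mem_walks] at hp
    obtain ⟨⟨⟨hω, hω0⟩, ⟨hωl, hωs⟩, hωe⟩, ⟨hη, hη0⟩, ⟨hηl, hηs⟩, hηe⟩ := hp
    have hηp : ∀ i ≤ m, 0 ≤ η i 0 := fun i hi => by simpa [hη0] using hηs i hi
    have hωp : ∀ i ≤ n, 0 ≤ ω i 0 := fun i hi => by simpa [hω0] using hωs i hi
    have hj0 : join n ω η 0 = 0 := by rw [join_of_le _ _ (Nat.zero_le n), hω0]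
    refine ⟨mem_walks.mpr ⟨isHalfWalk_join hω hη hωe hηp (fun j _ => by simp [hη0]) ?_, hj0⟩,
      ⟨⟨?_, ?_⟩, ?_⟩, contacts_join n m ω η⟩
    · change (η 0).height = (ω n).height
      rw [hη0, hωl]; rfl
    · rw [EndsLow, show n + m + 1 = n + 1 + m by ring, Site.height, join_add_last]
      exact hηl
    · intro i hi
      rw [hj0]
      rcases le_or_gt i n with h | h
      · rw [join_of_le _ _ h]; exact hωp i h
      · obtain ⟨k, rfl⟩ : ∃ k, i = n + 1 + k := ⟨i - (n + 1), by omega⟩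
        rw [join_add_zero]
        have := hηp k (by omega)
        have := hωp n le_rfl
        simp only [Pi.zero_apply]
        linarith
    · intro i hi
      rw [show n + m + 1 = n + 1 + m by ring, join_add_zero]
      rcases le_or_gt i n with h | h
      · rw [join_of_le _ _ h]
        linarith [hωe i h, hηp m le_rfl]
      · obtain ⟨k, rfl⟩ : ∃ k, i = n + 1 + k := ⟨i - (n + 1), by omega⟩
        rw [join_add_zero]
        linarith [hηe k (by omega)]
  · rintro ⟨ω, η⟩ hp ⟨ω', η'⟩ hp' h
    simp only [Finset.coe_product, Set.mem_prod, Finset.mem_coe, Finset.mem_filter,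
      mem_walks] at hp hp'
    obtain ⟨h1, h2⟩ : ω = ω' ∧ η = η' :=
      join_injective hp.1.1.1.eventuallyConst hp'.1.1.1.eventuallyConst h
    rw [h1, h2]

lemma height_le {d n : ℕ} {ω : ℕ → Site d} (hω : ω ∈ walks d n) :
    0 ≤ (ω n).height ∧ (ω n).height ≤ n := by
  obtain ⟨hw, h0⟩ := mem_walks.mp hω
  refine ⟨hw.nonneg n le_rfl, ?_⟩
  have h1 := hw.sub_le (Fin.last d) (Nat.zero_le n) le_rfl
  rw [h0] at h1
  simpa [Site.height] using h1

/-- Two walks which end at the same height, farthest to the right, make a loop: the second one is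
run backwards after the first one. By the Cauchy–Schwarz inequality, restricting to pairs with equal
final heights costs at most the number of possible heights. -/
theorem sq_weight_endMax_le {d : ℕ} [NeZero d] {a : ℝ} (ha : 0 < a) (n : ℕ) :
    weight d a n (EndMax n) ^ 2 ≤ (n + 1) * weight d a (n + n + 1) (EndsLow (n + n + 1)) := by
  classical
  set s := (walks d n).filter (EndMax n) with hs
  set H := Finset.Icc (0 : ℤ) n with hH
  have hmaps : ∀ ω ∈ s, (ω n).height ∈ H := fun ω hω =>
    Finset.mem_Icc.mpr (height_le (Finset.mem_filter.mp hω).1)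
  have h1 : weight d a n (EndMax n) =
      ∑ h ∈ H, ∑ ω ∈ s with (ω n).height = h, a ^ contacts n ω :=
    (Finset.sum_fiberwise_of_maps_to hmaps _).symm
  have hcard : (H.card : ℝ) = n + 1 := by
    rw [hH, Int.card_Icc]
    rw [show ((n : ℤ) + 1 - 0).toNat = n + 1 by omega]
    push_cast
    ring
  have h2 : ∑ h ∈ H, (∑ ω ∈ s with (ω n).height = h, a ^ contacts n ω) ^ 2 =
      ∑ p ∈ (s ×ˢ s) with (p.1 n).height = (p.2 n).height,
        a ^ contacts n p.1 * a ^ contacts n p.2 := by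
    rw [← Finset.sum_fiberwise_of_maps_to (s := (s ×ˢ s).filter _) (t := H)
      (g := fun p => (p.1 n).height) fun p hp =>
        hmaps p.1 (Finset.mem_product.mp (Finset.mem_filter.mp hp).1).1]
    refine Finset.sum_congr rfl fun h _ => ?_
    rw [sq, Finset.sum_mul_sum, ← Finset.sum_product']
    refine Finset.sum_congr ?_ fun _ _ => rfl
    ext p
    simp only [Finset.mem_product, Finset.mem_filter]
    constructor
    · rintro ⟨⟨h1, h2⟩, h3, h4⟩
      exact ⟨⟨⟨h1, h3⟩, h2.trans h4.symm⟩, h2⟩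
    · rintro ⟨⟨⟨h1, h3⟩, h4⟩, h2⟩
      exact ⟨⟨h1, h2⟩, h3, h4.symm.trans h2⟩
  rw [h1]
  refine sq_sum_le_card_mul_sum_sq.trans ?_
  rw [hcard, h2]
  refine mul_le_mul_of_nonneg_left ?_ (by positivity)
  refine sum_product_le_weight ha _ (fun p => join n p.1 (rev n p.2)) ?_ ?_
  · rintro ⟨ω, η⟩ hp
    simp only [hs, Finset.mem_product, Finset.mem_filter, mem_walks] at hp
    obtain ⟨⟨⟨⟨hω, hω0⟩, hωe⟩, ⟨hη, hη0⟩, hηe⟩, hh⟩ := hp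
    refine ⟨mem_walks.mpr ⟨isHalfWalk_join hω hη.rev hωe (fun i _ => ?_) (fun j hj => ?_) ?_, ?_⟩,
      ?_, ?_⟩
    · rw [rev_of_ne _ _ _ last_ne_zero.symm]
      linarith [hηe (n - i) (Nat.sub_le n i)]
    · simp [rev_of_ne _ _ _ hj]
    · rw [height_rev, Nat.sub_zero, hh]
    · exact (join_of_le _ _ (Nat.zero_le n)).trans hω0
    · rw [EndsLow, show n + n + 1 = n + 1 + n by ring, Site.height, join_add_last, rev_last,
        Nat.sub_self]
      exact congrFun hη0 _
    · rw [contacts_join, contacts_rev]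
  · rintro ⟨ω, η⟩ hp ⟨ω', η'⟩ hp' h
    simp only [hs, Finset.coe_filter, Finset.mem_product, Set.mem_ofPred_eq,
      Finset.mem_filter] at hp hp'
    obtain ⟨h3, h4⟩ := join_injective (mem_walks.mp hp.1.1.1).1.eventuallyConst
      (mem_walks.mp hp'.1.1.1).1.eventuallyConst h
    have h5 := rev_injOn (T := fun _ => True) ⟨hp.1.2.1, trivial⟩ ⟨hp'.1.2.1, trivial⟩ h4
    rw [h3, h5]

lemma weight_loop_endMax_le {d : ℕ} [NeZero d] {a : ℝ} (ha : 0 < a) (n : ℕ) :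
    weight d a n (fun ω => EndsLow n ω ∧ EndMax n ω) ≤
      weight d a n (fun ω => EndsLow n ω ∧ StartMin n ω) := by
  refine weight_le_of_injOn ha (rev n) ?_ rev_injOn
  rintro ω hω ⟨hl, he⟩
  obtain ⟨hw, h0⟩ := mem_walks.mp hω
  refine ⟨mem_walks.mpr ⟨hw.rev, ?_⟩, ⟨?_, fun i _ => ?_⟩, contacts_rev n ω⟩
  · ext j
    by_cases hj : j = Fin.last d
    · subst hj
      rw [rev_last, Nat.sub_zero]
      exact hl
    · simp [rev_of_ne _ _ _ hj]
  · rw [EndsLow, height_rev, Nat.sub_self, h0]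
    rfl
  · rw [rev_of_ne _ _ _ last_ne_zero.symm, rev_of_ne _ _ _ last_ne_zero.symm, Nat.sub_zero]
    linarith [he (n - i) (Nat.sub_le n i)]

lemma flipStable_true {d : ℕ} (n : ℕ) : FlipStable n fun _ : ℕ → Site d => True :=
  fun _ _ _ _ _ => trivial

lemma flipStable_endsLow {d : ℕ} [NeZero d] (n : ℕ) :
    FlipStable n (EndsLow n : (ℕ → Site d) → Prop) := by
  intro ω c _ _ h
  rw [EndsLow, height_flip]
  exact h

lemma flipStable_startMin {d : ℕ} (n : ℕ) :
    FlipStable n (StartMin n : (ℕ → Site d) → Prop) := by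
  intro ω c hc hmax h i hi
  rw [flip_of_le _ (Nat.zero_le c)]
  rcases le_or_gt i c with hic | hic
  · rw [flip_of_le _ hic]
    exact h i hi
  · rw [flip_of_ge _ hic.le, reflect_zero]
    linarith [h c hc, hmax i hi]

/-- Every loop can be unfolded at both ends. -/
theorem weight_loop_le {d : ℕ} [NeZero d] {a : ℝ} (ha : 0 < a) (n : ℕ) :
    weight d a n (EndsLow n) ≤
      (n + 1 : ℝ) ^ (2 * unfoldBound n) * weight d a n (IsUnfoldedLoop n) := by
  calc weight d a n (EndsLow n)
      ≤ (n + 1 : ℝ) ^ unfoldBound n * weight d a n (fun ω => EndsLow n ω ∧ EndMax n ω) :=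
        weight_le_weight_endMax ha (flipStable_endsLow n)
    _ ≤ (n + 1 : ℝ) ^ unfoldBound n * weight d a n (fun ω => EndsLow n ω ∧ StartMin n ω) := by
        gcongr
        exact weight_loop_endMax_le ha n
    _ ≤ (n + 1 : ℝ) ^ unfoldBound n *
          ((n + 1 : ℝ) ^ unfoldBound n * weight d a n (IsUnfoldedLoop n)) := by
        gcongr
        refine weight_le_weight_endMax ha fun ω c hc hmax h => ?_
        exact ⟨flipStable_endsLow n ω c hc hmax h.1, flipStable_startMin n ω c hc hmax h.2⟩
    _ = _ := by rw [two_mul, pow_add, mul_assoc]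

/-- The square of the weight of all walks is, up to a subexponential factor, at most the weight of
the unfolded loops of twice the length. -/
theorem sq_weight_le {d : ℕ} [NeZero d] {a : ℝ} (ha : 0 < a) (n : ℕ) :
    weight d a n (fun _ => True) ^ 2 ≤
      (2 * n + 2 : ℝ) ^ (4 * unfoldBound (2 * n + 1) + 1) *
        weight d a (2 * n + 1) (IsUnfoldedLoop (2 * n + 1)) := by
  have hK : unfoldBound n ≤ unfoldBound (2 * n + 1) :=
    Nat.succ_le_succ (Nat.sqrt_le_sqrt (by omega))
  have h1 := weight_le_weight_endMax ha (flipStable_true (d := d) n)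
  simp only [true_and] at h1
  have h2 := sq_weight_endMax_le (d := d) ha n
  have h3 := weight_loop_le (d := d) ha (2 * n + 1)
  rw [show n + n + 1 = 2 * n + 1 by ring] at h2
  set K := unfoldBound (2 * n + 1)
  have hb : (1 : ℝ) ≤ 2 * n + 2 := by linarith [(Nat.cast_nonneg n : (0 : ℝ) ≤ n)]
  have hb' : (n + 1 : ℝ) ≤ 2 * n + 2 := by linarith [(Nat.cast_nonneg n : (0 : ℝ) ≤ n)]
  have hL := weight_nonneg (d := d) ha (2 * n + 1) (IsUnfoldedLoop (2 * n + 1))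
  have hE := weight_nonneg (d := d) ha (2 * n + 1) (EndsLow (2 * n + 1))
  have h4 : (n + 1 : ℝ) ^ unfoldBound n ≤ (2 * n + 2 : ℝ) ^ K :=
    (pow_le_pow_left₀ (by positivity) hb' _).trans (pow_le_pow_right₀ hb hK)
  have h5 : ((2 * n + 1 : ℕ) + 1 : ℝ) = 2 * n + 2 := by push_cast; ring
  rw [h5] at h3
  calc weight d a n (fun _ => True) ^ 2
      ≤ ((n + 1 : ℝ) ^ unfoldBound n * weight d a n (EndMax n)) ^ 2 :=
        pow_le_pow_left₀ (weight_nonneg ha n _) h1 2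
    _ = ((n + 1 : ℝ) ^ unfoldBound n) ^ 2 * weight d a n (EndMax n) ^ 2 := by ring
    _ ≤ ((2 * n + 2 : ℝ) ^ K) ^ 2 * ((n + 1) * weight d a (2 * n + 1) (EndsLow (2 * n + 1))) := by
        gcongr
    _ ≤ ((2 * n + 2 : ℝ) ^ K) ^ 2 * ((2 * n + 2) * ((2 * n + 2 : ℝ) ^ (2 * K) *
          weight d a (2 * n + 1) (IsUnfoldedLoop (2 * n + 1)))) := by
        gcongr
    _ = _ := by ring

/-! ### The limiting free energy -/

lemma card_walks_le (d n : ℕ) : (walks d n).card ≤ (3 ^ (d + 1)) ^ n := by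
  classical
  have h1 : (Fintype.piFinset fun _ : Fin n => Fintype.piFinset fun _ : Fin (d + 1) =>
      Finset.Icc (-1 : ℤ) 1).card = (3 ^ (d + 1)) ^ n := by
    simp
  rw [← h1]
  refine Finset.card_le_card_of_injOn (fun ω i j => ω i j - ω (i + 1) j) ?_ ?_
  · intro ω hω
    have hw := (mem_walks.mp (Finset.mem_coe.mp hω)).1
    simp only [Finset.mem_coe, Fintype.mem_piFinset, Finset.mem_Icc]
    intro i j
    exact abs_le.mp ((hw.step i i.isLt).abs_sub_le j)
  · intro ω hω η hη h
    obtain ⟨hw, h0⟩ := mem_walks.mp (Finset.mem_coe.mp hω)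
    obtain ⟨hw', h0'⟩ := mem_walks.mp (Finset.mem_coe.mp hη)
    have h2 : ∀ i ≤ n, ω i = η i := by
      intro i
      induction i with
      | zero => intro _; rw [h0, h0']
      | succ i ih =>
        intro hi
        ext j
        have h3 := congrFun (congrFun h ⟨i, hi⟩) j
        have h4 := congrFun (ih (by omega)) j
        simp only at h3
        linarith
    ext1 i
    rcases le_total i n with hi | hi
    · exact h2 i hi
    · rw [hw.eventuallyConst i hi, hw'.eventuallyConst i hi, h2 n le_rfl]

lemma weight_le_pow {d : ℕ} {a : ℝ} (ha : 0 < a) (n : ℕ) (T : (ℕ → Site d) → Prop) :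
    weight d a n T ≤ (3 ^ (d + 1) * max 1 a) ^ (n + 1) := by
  classical
  have h1 : (1 : ℝ) ≤ max 1 a := le_max_left _ _
  have h2 : (1 : ℝ) ≤ 3 ^ (d + 1) := one_le_pow₀ (by norm_num)
  calc weight d a n T ≤ ∑ ω ∈ (walks d n).filter T, (max 1 a) ^ (n + 1) := by
        refine Finset.sum_le_sum fun ω _ => ?_
        refine (pow_le_pow_left₀ ha.le (le_max_right 1 a) _).trans (pow_le_pow_right₀ h1 ?_)
        exact (Finset.card_filter_le _ _).trans (by simp)
    _ = ((walks d n).filter T).card * (max 1 a) ^ (n + 1) := by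
        rw [Finset.sum_const, nsmul_eq_mul]
    _ ≤ (3 ^ (d + 1)) ^ (n + 1) * (max 1 a) ^ (n + 1) := by
        gcongr
        calc (((walks d n).filter T).card : ℝ) ≤ ((3 ^ (d + 1)) ^ n : ℕ) := by
              exact_mod_cast (Finset.card_filter_le _ _).trans (card_walks_le d n)
          _ = (3 ^ (d + 1) : ℝ) ^ n := by push_cast; rfl
          _ ≤ _ := pow_le_pow_right₀ h2 (Nat.le_succ n)
    _ = _ := by rw [mul_pow]

/-- The straight walk along coordinate `0`. -/
def straight (d n i : ℕ) : Site d := fun j => if j = 0 then (min i n : ℕ) else 0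

lemma weight_unfoldedLoop_pos {d : ℕ} [NeZero d] {a : ℝ} (ha : 0 < a) (n : ℕ) :
    0 < weight d a n (IsUnfoldedLoop n) := by
  classical
  have hh : ∀ i, (straight d n i).height = 0 := fun i => by
    simp [straight, Site.height, NeZero.ne d]
  have hx : ∀ i, straight d n i 0 = (min i n : ℕ) := fun i => by simp [straight]
  have hw : IsHalfWalk n (straight d n) := by
    refine ⟨fun i hi => ?_, fun i hi j hj hij => ?_, fun i _ => (hh i).ge, fun i hi => ?_⟩
    · have h1 : ∀ j, |straight d n i j - straight d n (i + 1) j| = if j = 0 then 1 else 0 := by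
        intro j
        unfold straight
        split_ifs
        · rw [min_eq_left hi.le, min_eq_left (Nat.succ_le_of_lt hi)]
          simp
        · simp
      unfold Site.Adj
      rw [Finset.sum_congr rfl fun j _ => h1 j]
      simp
    · have h1 := congrFun hij 0
      rw [hx, hx] at h1
      omega
    · unfold straight
      rw [min_eq_right hi, min_self]
  have hm : straight d n ∈ (walks d n).filter (IsUnfoldedLoop n) := by
    refine Finset.mem_filter.mpr ⟨mem_walks.mpr ⟨hw, ?_⟩, ⟨hh n, fun i _ => ?_⟩, fun i hi => ?_⟩
    · ext j
      simp [straight]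
    · rw [hx, hx]; omega
    · rw [hx, hx]; omega
  exact Finset.sum_pos (fun _ _ => by positivity) ⟨_, hm⟩

/-- Unfolded loops are supermultiplicative up to an index shift, so Fekete's lemma applies. -/
lemma exists_tendsto_log_unfoldedLoop (d : ℕ) [NeZero d] {a : ℝ} (ha : 0 < a) :
    ∃ l : ℝ, Tendsto (fun n : ℕ => Real.log (weight d a n (IsUnfoldedLoop n)) / (n + 1 : ℝ))
      atTop (𝓝 l) := by
  -- The connecting step in a concatenation is absorbed by shifting the index by one.
  set u : ℕ → ℝ := fun n => Nat.rec 0 (fun k _ => -Real.log (weight d a k (IsUnfoldedLoop k))) n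
    with hu
  have hpos := fun n => weight_unfoldedLoop_pos (d := d) ha n
  have h1 : Subadditive u := by
    intro m n
    rcases m with _ | m
    · simp [hu]
    rcases n with _ | n
    · simp [hu]
    · have h2 := Real.log_le_log (mul_pos (hpos m) (hpos n)) (weight_unfoldedLoop_mul_le ha m n)
      rw [Real.log_mul (hpos m).ne' (hpos n).ne'] at h2
      rw [show m + 1 + (n + 1) = m + n + 1 + 1 by ring]
      simp only [hu]
      linarith
  have h2 : BddBelow (Set.range fun n => u n / n) := by
    set M : ℝ := 3 ^ (d + 1) * max 1 a
    have hM : 1 ≤ M := one_le_mul_of_one_le_of_one_le (one_le_pow₀ (by norm_num)) (le_max_left _ _)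
    refine ⟨-Real.log M, ?_⟩
    rintro _ ⟨n, rfl⟩
    rcases n with _ | n
    · simpa [hu] using Real.log_nonneg hM
    · have h3 := Real.log_le_log (hpos n) (weight_le_pow ha n _)
      rw [Real.log_pow] at h3
      change -Real.log M ≤ -Real.log (weight d a n (IsUnfoldedLoop n)) / (n + 1 : ℕ)
      rw [le_div_iff₀ (by positivity)]
      linarith
  refine ⟨-h1.lim, ?_⟩
  have h3 := ((h1.tendsto_lim h2).comp (tendsto_add_atTop_nat 1)).neg
  refine h3.congr fun n => ?_
  simp [hu, neg_div]

lemma tendsto_unfoldBound_mul_log :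
    Tendsto (fun n : ℕ => (4 * unfoldBound (2 * n + 1) + 1 : ℕ) * Real.log (2 * n + 2) / (2 * n))
      atTop (𝓝 0) := by
  have h1 : Tendsto (fun x : ℝ => 26 * (Real.log x / x ^ (1 / 2 : ℝ))) atTop (𝓝 (26 * 0)) :=
    ((isLittleO_log_rpow_atTop (by norm_num : (0 : ℝ) < 1 / 2)).tendsto_div_nhds_zero).const_mul _
  rw [mul_zero] at h1
  have h2 : Tendsto (fun n : ℕ => (2 * n + 2 : ℝ)) atTop atTop :=
    tendsto_atTop_add_const_right _ _
      (tendsto_natCast_atTop_atTop.const_mul_atTop (by norm_num))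
  refine squeeze_zero' (Eventually.of_forall fun n => ?_) ?_ (h1.comp h2)
  · have : 0 ≤ Real.log (2 * n + 2) :=
      Real.log_nonneg (by linarith [(Nat.cast_nonneg n : (0 : ℝ) ≤ n)])
    positivity
  · filter_upwards [eventually_ge_atTop 1] with n hn
    have hn : (1 : ℝ) ≤ n := by exact_mod_cast hn
    simp only [Function.comp, ← Real.sqrt_eq_rpow]
    set x : ℝ := 2 * n + 2 with hx
    have hx4 : (4 : ℝ) ≤ x := by linarith
    have hlog : 0 ≤ Real.log x := Real.log_nonneg (by linarith)
    have hs : 2 ≤ √x := Real.le_sqrt_of_sq_le (by linarith)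
    have hss : √x * √x = x := Real.mul_self_sqrt (by linarith)
    have hsq : ((2 * (2 * n + 1)).sqrt : ℝ) ≤ 2 * √x := by
      refine (Real.nat_sqrt_le_real_sqrt).trans (Real.sqrt_le_iff.mpr ⟨by positivity, ?_⟩)
      push_cast
      nlinarith
    have hK : ((4 * unfoldBound (2 * n + 1) + 1 : ℕ) : ℝ) ≤ 13 * √x := by
      unfold unfoldBound
      push_cast
      linarith
    rw [← mul_div_assoc, div_le_div_iff₀ (by positivity) (by positivity)]
    calc ((4 * unfoldBound (2 * n + 1) + 1 : ℕ) : ℝ) * Real.log x * √x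
        ≤ 13 * √x * Real.log x * √x := by gcongr
      _ = 13 * Real.log x * x := by linear_combination 13 * Real.log x * hss
      _ ≤ 13 * Real.log x * (2 * (2 * n)) := by gcongr; linarith
      _ = _ := by ring

/-- All walks grow at the rate of the unfolded loops: they are squeezed between these and the square
root of the weight of the unfolded loops of twice the length. -/
lemma exists_tendsto_log_weight (d : ℕ) [NeZero d] {a : ℝ} (ha : 0 < a) :
    ∃ l : ℝ, Tendsto (fun n : ℕ => Real.log (weight d a n fun _ => True) / n) atTop (𝓝 l) := by
  obtain ⟨l, hl⟩ := exists_tendsto_log_unfoldedLoop d ha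
  have hpos := fun n => weight_unfoldedLoop_pos (d := d) ha n
  have hle : ∀ n, weight d a n (IsUnfoldedLoop n) ≤ weight d a n fun _ => True := fun n =>
    weight_mono ha n fun _ _ _ => trivial
  have hratio : Tendsto (fun n : ℕ => (n + 1 : ℝ) / n) atTop (𝓝 1) := by
    have h1 : Tendsto (fun n : ℕ => 1 + 1 / (n : ℝ)) atTop (𝓝 (1 + 0)) :=
      tendsto_const_nhds.add tendsto_one_div_atTop_nhds_zero_nat
    rw [add_zero] at h1
    refine h1.congr' ?_
    filter_upwards [eventually_ne_atTop 0] with n hn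
    have : (n : ℝ) ≠ 0 := by exact_mod_cast hn
    field_simp
  refine ⟨l, tendsto_of_tendsto_of_tendsto_of_le_of_le' (g := fun n : ℕ =>
    Real.log (weight d a n (IsUnfoldedLoop n)) / (n + 1 : ℝ) * ((n + 1 : ℝ) / n))
    (h := fun n : ℕ =>
      (4 * unfoldBound (2 * n + 1) + 1 : ℕ) * Real.log (2 * n + 2) / (2 * n) +
        Real.log (weight d a (2 * n + 1) (IsUnfoldedLoop (2 * n + 1))) / ((2 * n + 1 : ℕ) + 1 : ℝ)
          * ((n + 1 : ℝ) / n)) ?_ ?_ ?_ ?_⟩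
  · simpa using hl.mul hratio
  · have h1 : Tendsto (fun n : ℕ => 2 * n + 1) atTop atTop :=
      tendsto_atTop_mono (fun n => by simp only [id]; omega) tendsto_id
    simpa using tendsto_unfoldBound_mul_log.add ((hl.comp h1).mul hratio)
  · filter_upwards [eventually_ne_atTop 0] with n hn
    have hn : (0 : ℝ) < n := by exact_mod_cast Nat.pos_of_ne_zero hn
    rw [div_mul_div_cancel₀ (by positivity)]
    gcongr
    · exact hpos n
    · exact hle n
  · filter_upwards [eventually_ne_atTop 0] with n hn
    have hn : (0 : ℝ) < n := by exact_mod_cast Nat.pos_of_ne_zero hn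
    have h1 := Real.log_le_log (pow_pos ((hpos n).trans_le (hle n)) 2) (sq_weight_le ha n)
    rw [Real.log_pow, Real.log_mul (by positivity) (hpos _).ne', Real.log_pow] at h1
    have h2 : Real.log (weight d a (2 * n + 1) (IsUnfoldedLoop (2 * n + 1))) /
        ((2 * n + 1 : ℕ) + 1 : ℝ) * ((n + 1 : ℝ) / n) =
        Real.log (weight d a (2 * n + 1) (IsUnfoldedLoop (2 * n + 1))) / (2 * n) := by
      push_cast
      field_simp
      ring
    rw [h2, ← add_div, div_le_div_iff₀ hn (by positivity)]
    push_cast at h1 ⊢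
    nlinarith

/-- On the half-line the only positive walk goes straight away from the boundary. -/
lemma partitionFunction_zero_dim (n : ℕ) (a : ℝ) : partitionFunction 0 n a = 1 := by
  have hcoord : ∀ (w : Fin (n + 1) → Site 0), IsPositiveWalk w → ∀ i ≤ n, stopped w i 0 = i := by
    intro w hw i
    have h := hw.stopped
    induction i using Nat.strong_induction_on with
    | _ i ih =>
    intro hi
    rcases i with _ | i
    · rw [stopped_of_le w hi]
      exact congrFun hw.start 0
    · have h1 : |stopped w i 0 - stopped w (i + 1) 0| = 1 :=
        (Fin.sum_univ_one _).symm.trans (h.step i hi)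
      rw [ih i (by omega) (by omega)] at h1
      have h2 : 0 ≤ stopped w (i + 1) 0 := h.nonneg _ hi
      rcases (abs_eq zero_le_one).mp h1 with h3 | h3
      · -- A step back returns to the vertex visited two steps before.
        rcases i with _ | k
        · simp only [Nat.cast_zero] at h3
          omega
        · have h4 : stopped w (k + 1 + 1) = stopped w k := by
            ext j
            obtain rfl : j = 0 := Fin.fin_one_eq_zero j
            rw [ih k (by omega) (by omega)]
            push_cast at h3
            linarith
          have := h.inj _ hi _ (by omega) h4
          omega
      · push_cast
        linarith
  have hset : (finite_positiveWalks 0 n).toFinset =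
      {(fun i _ => ((i : ℕ) : ℤ) : Fin (n + 1) → Site 0)} := by
    ext w
    simp only [Set.Finite.mem_toFinset, Set.mem_ofPred_eq, Finset.mem_singleton]
    constructor
    · intro hw
      ext i j
      obtain rfl : j = 0 := Fin.fin_one_eq_zero j
      rw [← stopped_val w i, hcoord w hw i (by omega)]
    · rintro rfl
      refine ⟨rfl, fun i => ?_, fun i j hij => ?_, fun i => ?_⟩
      · simp [Site.Adj]
      · simpa [Fin.ext_iff] using congrFun hij 0
      · simp [Site.height]
  have hvisits : visits (fun (i : Fin (n + 1)) (_ : Fin (0 + 1)) => ((i : ℕ) : ℤ)) = 0 := by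
    simp [visits, Site.height]
  rw [partitionFunction_eq_sum, hset, Finset.sum_singleton, hvisits, pow_zero]

/-- The adsorbing walk has a limiting free energy. -/
theorem exists_tendsto_log_partitionFunction (d : ℕ) {a : ℝ} (ha : 0 < a) :
    (∀ n, 0 < partitionFunction d n a) ∧
      ∃ l : ℝ, Tendsto (fun n : ℕ => Real.log (partitionFunction d n a) / n) atTop (𝓝 l) := by
  rcases Nat.eq_zero_or_pos d with rfl | hd
  · simp only [partitionFunction_zero_dim, zero_lt_one, implies_true, Real.log_one, zero_div,
      true_and]
    exact ⟨0, tendsto_const_nhds⟩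
  · have : NeZero d := ⟨hd.ne'⟩
    have hpos : ∀ n, 0 < partitionFunction d n a := fun n => by
      have h1 := (weight_unfoldedLoop_pos (d := d) ha n).trans_le
        (weight_mono ha n fun _ _ _ => trivial)
      rw [weight_true] at h1
      exact pos_of_mul_pos_right h1 ha.le
    obtain ⟨l, hl⟩ := exists_tendsto_log_weight d ha
    refine ⟨hpos, l, ?_⟩
    have h1 : Tendsto (fun n : ℕ => Real.log a / n) atTop (𝓝 0) :=
      tendsto_const_nhds.div_atTop tendsto_natCast_atTop_atTop
    have h2 := hl.sub h1
    rw [sub_zero] at h2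
    refine h2.congr fun n => ?_
    rw [weight_true, Real.log_mul ha.ne' (hpos n).ne', ← sub_div, add_sub_cancel_left]

/-! ### Bounds for power sums of the directions of zeros -/

/-- The coefficient `-∑ η i` of `w` in `log ∏ (1 - w * η i)` is bounded by the Borel–Carathéodory
theorem, as the real part of this function is at most `H` on the unit disc. -/
lemma norm_sum_le_of_norm_prod_le {ι : Type*} [Fintype ι] (η : ι → ℂ) (hη : ∀ i, ‖η i‖ ≤ 1)
    {H : ℝ} (hH : 0 < H) (h : ∀ w : ℂ, ‖w‖ = 1 → ‖∏ i, (1 - w * η i)‖ ≤ Real.exp H) :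
    ‖∑ i, η i‖ ≤ 2 * H := by
  set f : ℂ → ℂ := fun w => ∑ i, Complex.log (1 - w * η i) with hf
  have hslit : ∀ w ∈ Metric.ball (0 : ℂ) 1, ∀ i, 1 - w * η i ∈ Complex.slitPlane := by
    intro w hw i
    rw [sub_eq_add_neg]
    refine Complex.mem_slitPlane_of_norm_lt_one ?_
    rw [norm_neg, norm_mul]
    rw [mem_ball_zero_iff] at hw
    nlinarith [hη i, norm_nonneg w, norm_nonneg (η i)]
  have hderiv : ∀ w ∈ Metric.ball (0 : ℂ) 1, HasDerivAt f (∑ i, -η i / (1 - w * η i)) w := by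
    intro w hw
    refine HasDerivAt.fun_sum fun i _ => ?_
    refine HasDerivAt.clog ?_ (hslit w hw i)
    simpa using ((hasDerivAt_id w).mul_const (η i)).const_sub 1
  have hmax : ∀ w ∈ Metric.ball (0 : ℂ) 1, ‖∏ i, (1 - w * η i)‖ ≤ Real.exp H := by
    intro w hw
    refine Complex.norm_le_of_forall_mem_frontier_norm_le (f := fun w => ∏ i, (1 - w * η i))
      Metric.isBounded_ball (Differentiable.diffContOnCl (by fun_prop)) ?_ (subset_closure hw)
    intro z hz
    rw [frontier_ball _ one_ne_zero, mem_sphere_zero_iff_norm] at hz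
    exact h z hz
  have hre : Set.MapsTo f (Metric.ball 0 1) {z | z.re ≤ H} := by
    intro w hw
    have hne : ∀ i, 1 - w * η i ≠ 0 := fun i => Complex.slitPlane_ne_zero (hslit w hw i)
    have h1 : (f w).re = Real.log ‖∏ i, (1 - w * η i)‖ := by
      rw [norm_prod, Real.log_prod fun i _ => norm_ne_zero_iff.mpr (hne i), hf, Complex.re_sum]
      exact Finset.sum_congr rfl fun i _ => Complex.log_re _
    change (f w).re ≤ H
    rw [h1, Real.log_le_iff_le_exp
      (norm_pos_iff.mpr (Finset.prod_ne_zero_iff.mpr fun i _ => hne i))]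
    exact hmax w hw
  have hf0 : f 0 = 0 := by simp [hf]
  have h0 : HasDerivAt f (-∑ i, η i) 0 := by
    simpa using hderiv 0 (Metric.mem_ball_self one_pos)
  have h2 := h0.tendsto_slope_zero.norm
  rw [norm_neg] at h2
  have h3 : Tendsto (fun t : ℂ => 2 * H / (1 - ‖t‖)) (𝓝[≠] 0) (𝓝 (2 * H)) := by
    have h4 : ContinuousAt (fun t : ℂ => 2 * H / (1 - ‖t‖)) 0 :=
      ContinuousAt.div (by fun_prop) (by fun_prop) (by simp)
    have h5 := h4.tendsto.mono_left (nhdsWithin_le_nhds (s := {0}ᶜ))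
    simpa using h5
  refine le_of_tendsto_of_tendsto h2 h3 ?_
  have h6 : Metric.ball (0 : ℂ) 1 ∈ 𝓝[≠] (0 : ℂ) :=
    mem_nhdsWithin_of_mem_nhds (Metric.ball_mem_nhds 0 one_pos)
  filter_upwards [h6, self_mem_nhdsWithin] with t ht ht0
  have h7 := Complex.borelCaratheodory_zero hH
    (fun w hw => (hderiv w hw).differentiableAt.differentiableWithinAt) hre one_pos ht hf0
  have htpos : 0 < ‖t‖ := norm_pos_iff.mpr ht0
  rw [zero_add, hf0, sub_zero, norm_smul, norm_inv, inv_mul_le_iff₀ htpos]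
  calc ‖f t‖ ≤ _ := h7
    _ = _ := by ring

/-- The power sums of unit complex numbers `ζ i` are small if `∏ ‖u - ζ i‖` is not large on the
unit circle. The product over the `k`-th roots of unity reduces the claim to `k = 1`. -/
lemma norm_sum_pow_le {ι : Type*} [Fintype ι] (ζ : ι → ℂ) (hζ : ∀ i, ‖ζ i‖ = 1) {h : ℝ}
    (hh : 0 < h) (hprod : ∀ u : ℂ, ‖u‖ = 1 → ∏ i, ‖u - ζ i‖ ≤ Real.exp h) {k : ℕ} (hk : 0 < k) :
    ‖∑ i, ζ i ^ k‖ ≤ 2 * (k * h) := by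
  have hk' : (0 : ℝ) < k := by exact_mod_cast hk
  have hne : ∀ i, ζ i ≠ 0 := fun i => norm_ne_zero_iff.mp (by rw [hζ i]; exact one_ne_zero)
  have hconj : ∀ i, (starRingEnd ℂ) (ζ i ^ k) = (ζ i ^ k)⁻¹ := fun i =>
    (Complex.inv_eq_conj (by rw [norm_pow, hζ i, one_pow])).symm
  have key : ‖∑ i, (starRingEnd ℂ) (ζ i ^ k)‖ ≤ 2 * (k * h) := by
    refine norm_sum_le_of_norm_prod_le _ (fun i => ?_) (by positivity) fun w hw => ?_
    · rw [RCLike.norm_conj, norm_pow, hζ i, one_pow]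
    obtain ⟨u, hu⟩ := IsAlgClosed.exists_pow_nat_eq w hk
    have hu1 : ‖u‖ = 1 := by
      have h1 : ‖u‖ ^ k = 1 := by rw [← norm_pow, hu, hw]
      exact (pow_eq_one_iff_of_nonneg (norm_nonneg u) hk.ne').mp h1
    have hfac : ∀ i, ‖1 - w * (starRingEnd ℂ) (ζ i ^ k)‖ =
        ∏ ξ ∈ nthRootsFinset k (1 : ℂ), ‖ξ * u - ζ i‖ := by
      intro i
      have h1 : 1 - w * (starRingEnd ℂ) (ζ i ^ k) = (ζ i ^ k - u ^ k) * (ζ i ^ k)⁻¹ := by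
        rw [hconj, hu, sub_mul, mul_inv_cancel₀ (pow_ne_zero k (hne i))]
      rw [h1, norm_mul, norm_inv, norm_pow (ζ i), hζ i, one_pow, inv_one, mul_one,
        (Complex.isPrimitiveRoot_exp k hk.ne').pow_sub_pow_eq_prod_sub_mul _ _ hk, norm_prod]
      exact Finset.prod_congr rfl fun ξ _ => norm_sub_rev _ _
    rw [norm_prod, Finset.prod_congr rfl fun i _ => hfac i, Finset.prod_comm]
    calc ∏ ξ ∈ nthRootsFinset k (1 : ℂ), ∏ i, ‖ξ * u - ζ i‖
        ≤ ∏ ξ ∈ nthRootsFinset k (1 : ℂ), Real.exp h := by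
          refine Finset.prod_le_prod (fun _ _ => by positivity) fun ξ hξ => hprod _ ?_
          rw [norm_mul, hu1, mul_one]
          have h2 : ξ ^ k = 1 := (mem_nthRootsFinset hk _).mp hξ
          exact Complex.norm_eq_one_of_pow_eq_one h2 hk.ne'
      _ = Real.exp (k * h) := by
          rw [Finset.prod_const, (Complex.isPrimitiveRoot_exp k hk.ne').card_nthRootsFinset,
            Real.exp_nat_mul]
  rwa [← map_sum, RCLike.norm_conj] at key

/-- Schur's inequality: moving a zero radially to the circle of radius `r` does not increase the
suitably normalized distance to the points of that circle. -/
lemma mul_norm_sub_sq_le (r : ℝ) {u z : ℂ} (hu : ‖u‖ = 1) (hz : z ≠ 0) :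
    r * ‖z‖ * ‖u - z / ‖z‖‖ ^ 2 ≤ ‖r * u - z‖ ^ 2 := by
  have hz' : 0 < ‖z‖ := norm_pos_iff.mpr hz
  have h1 : ‖z‖ * ‖u - z / ‖z‖‖ ^ 2 = 2 * ‖z‖ - 2 * (u.re * z.re + u.im * z.im) := by
    have h2 : u - z / ‖z‖ = (‖z‖ * u - z) / ‖z‖ := by
      have : (‖z‖ : ℂ) ≠ 0 := by exact_mod_cast hz'.ne'
      field_simp
    have h3 : ‖(‖z‖ : ℂ) * u - z‖ ^ 2 = 2 * ‖z‖ ^ 2 - 2 * ‖z‖ * (u.re * z.re + u.im * z.im) := by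
      have h4 : ‖u‖ ^ 2 = 1 := by rw [hu, one_pow]
      have h5 : ‖z‖ ^ 2 = z.re * z.re + z.im * z.im := by rw [Complex.sq_norm, Complex.normSq_apply]
      rw [Complex.sq_norm, Complex.normSq_apply] at h4 ⊢
      simp only [Complex.sub_re, Complex.sub_im, Complex.re_ofReal_mul, Complex.im_ofReal_mul]
      linear_combination ‖z‖ ^ 2 * h4 - h5
    rw [h2, norm_div, div_pow, h3, Complex.norm_real, norm_norm]
    field_simp
  have h6 : ‖(r : ℂ) * u - z‖ ^ 2 = r ^ 2 + ‖z‖ ^ 2 - 2 * r * (u.re * z.re + u.im * z.im) := by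
    have h4 : ‖u‖ ^ 2 = 1 := by rw [hu, one_pow]
    rw [Complex.sq_norm, Complex.normSq_apply] at h4 ⊢
    rw [Complex.sq_norm, Complex.normSq_apply]
    simp only [Complex.sub_re, Complex.sub_im, Complex.re_ofReal_mul, Complex.im_ofReal_mul]
    linear_combination r ^ 2 * h4
  rw [mul_assoc, h1, h6]
  nlinarith [sq_nonneg (r - ‖z‖)]

/-- A product over directions of zeros is controlled on the unit circle by the modulus of the
polynomial on the circle of radius `r` and by the first and the last coefficient. -/
lemma prod_norm_sub_le {N : ℕ} (z : Fin N → ℂ) (hz : ∀ i, z i ≠ 0) {b₀ b₁ r S : ℝ} (hb₀ : 0 < b₀)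
    (hb₁ : 0 < b₁) (hr : 0 < r) (hb : b₁ * ∏ i, ‖z i‖ = b₀) {u : ℂ} (hu : ‖u‖ = 1)
    (hS : b₁ * ∏ i, ‖r * u - z i‖ ≤ S) :
    ∏ i, ‖u - z i / ‖z i‖‖ ≤
      Real.exp (Real.log S - (Real.log b₀ + Real.log (b₁ * r ^ N)) / 2) := by
  by_cases h0 : ∏ i, ‖u - z i / ‖z i‖‖ = 0
  · rw [h0]
    positivity
  have hQ : 0 < ∏ i, ‖u - z i / ‖z i‖‖ := lt_of_le_of_ne (by positivity) (Ne.symm h0)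
  set Q := ∏ i, ‖u - z i / ‖z i‖‖
  have h1 : r ^ N * (∏ i, ‖z i‖) * Q ^ 2 ≤ (∏ i, ‖r * u - z i‖) ^ 2 := by
    have h2 := Finset.prod_le_prod (s := Finset.univ) (fun i _ => by positivity)
      fun i _ => mul_norm_sub_sq_le r hu (hz i)
    simpa [Finset.prod_mul_distrib, Finset.prod_pow, Q] using h2
  have h3 : b₀ * (b₁ * r ^ N) * Q ^ 2 ≤ S ^ 2 := by
    calc b₀ * (b₁ * r ^ N) * Q ^ 2 = b₁ ^ 2 * (r ^ N * (∏ i, ‖z i‖) * Q ^ 2) := by rw [← hb]; ring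
      _ ≤ b₁ ^ 2 * (∏ i, ‖r * u - z i‖) ^ 2 := by gcongr
      _ = (b₁ * ∏ i, ‖r * u - z i‖) ^ 2 := by ring
      _ ≤ S ^ 2 := pow_le_pow_left₀ (by positivity) hS 2
  have h4 := Real.log_le_log (by positivity) h3
  rw [Real.log_mul (by positivity) (by positivity), Real.log_mul hb₀.ne' (by positivity),
    Real.log_pow, Real.log_pow] at h4
  rw [← Real.log_le_iff_le_exp hQ]
  push_cast at h4
  linarith

/-- An `o(n)` sequence lies below every line of positive slope, up to an additive constant. -/
lemma exists_le_mul_add {β : ℕ → ℝ} (hβ : Tendsto (fun n : ℕ => β n / n) atTop (𝓝 0)) {ε : ℝ}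
    (hε : 0 < ε) : ∃ K : ℝ, ∀ n : ℕ, |β n| ≤ ε * n + K := by
  obtain ⟨m, hm⟩ := eventually_atTop.mp ((hβ.abs.eventually_lt_const (by simpa using hε)).and
    (eventually_gt_atTop 0))
  refine ⟨∑ i ∈ Finset.range m, |β i|, fun n => ?_⟩
  have hsum : 0 ≤ ∑ i ∈ Finset.range m, |β i| := Finset.sum_nonneg fun _ _ => abs_nonneg _
  have hεn : 0 ≤ ε * n := by positivity
  rcases lt_or_ge n m with h | h
  · have := Finset.single_le_sum (f := fun i => |β i|) (fun i _ => abs_nonneg _)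
      (Finset.mem_range.mpr h)
    linarith
  · obtain ⟨h1, h2⟩ := hm n h
    have hn : (0 : ℝ) < n := by exact_mod_cast h2
    rw [abs_div, Nat.abs_cast, div_lt_iff₀ hn] at h1
    linarith

/-- Partial sums of a sequence of subexponential growth grow subexponentially. -/
lemma tendsto_log_sum_div {b : ℕ → ℝ} (hb : ∀ n, 0 < b n)
    (hlim : Tendsto (fun n : ℕ => Real.log (b n) / n) atTop (𝓝 0)) :
    Tendsto (fun N : ℕ => max (Real.log (∑ n ∈ Finset.range (N + 1), b n) -
      (Real.log (b 0) + Real.log (b N)) / 2) 1 / N) atTop (𝓝 0) := by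
  rw [Metric.tendsto_atTop']
  intro ε hε
  obtain ⟨K, hK⟩ := exists_le_mul_add hlim (show 0 < ε / 4 by positivity)
  have hlogN : Tendsto (fun N : ℕ => Real.log (N + 1 : ℝ) / (N + 1 : ℝ)) atTop (𝓝 0) :=
    ((Real.isLittleO_log_id_atTop.tendsto_div_nhds_zero).comp
      (tendsto_atTop_add_const_right _ (1 : ℝ) tendsto_natCast_atTop_atTop))
  have hconst : Tendsto (fun N : ℕ => (2 * K + |Real.log (b 0)| + 1) / N) atTop (𝓝 0) :=
    tendsto_const_nhds.div_atTop tendsto_natCast_atTop_atTop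
  obtain ⟨m, hm⟩ := eventually_atTop.mp ((hlogN.eventually_lt_const
    (show 0 < ε / 16 by positivity)).and ((hconst.eventually_lt_const
    (show 0 < ε / 4 by positivity)).and (eventually_gt_atTop 0)))
  refine ⟨m, fun N hN => ?_⟩
  obtain ⟨h1, h2, h3⟩ := hm N hN.le
  have hN0 : (1 : ℝ) ≤ N := by exact_mod_cast h3
  rw [div_lt_iff₀ (by positivity)] at h1 h2
  have hS : Real.log (∑ n ∈ Finset.range (N + 1), b n) ≤
      Real.log (N + 1 : ℝ) + (ε / 4 * N + K) := by
    have h4 : ∑ n ∈ Finset.range (N + 1), b n ≤ (N + 1 : ℝ) * Real.exp (ε / 4 * N + K) := by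
      calc _ ≤ ∑ n ∈ Finset.range (N + 1), Real.exp (ε / 4 * N + K) := by
            refine Finset.sum_le_sum fun n hn => ?_
            rw [← Real.log_le_iff_le_exp (hb n)]
            have hn : (n : ℝ) ≤ N := by
              exact_mod_cast Nat.lt_succ_iff.mp (Finset.mem_range.mp hn)
            have h5 := (le_abs_self _).trans (hK n)
            have : ε / 4 * n ≤ ε / 4 * N := by gcongr
            linarith
        _ = _ := by simp
    have h6 := Real.log_le_log (Finset.sum_pos (fun n _ => hb n) (by simp)) h4
    rwa [Real.log_mul (by positivity) (by positivity), Real.log_exp] at h6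
  have hbN := (neg_le_abs _).trans (hK N)
  have hb0 := neg_abs_le (Real.log (b 0))
  have hb0' := abs_nonneg (Real.log (b 0))
  have hK0 : 0 ≤ K := by simpa using (abs_nonneg _).trans (hK 0)
  have hεN : ε ≤ ε * N := le_mul_of_one_le_right hε.le hN0
  rw [Real.dist_eq, sub_zero, abs_of_nonneg (by positivity), div_lt_iff₀ (by positivity)]
  refine max_lt ?_ ?_ <;> linarith

/-! ### Weyl's criterion on the circle -/

open MeasureTheory in
/-- **Weyl's criterion** for triangular arrays of angles. -/
lemma tendsto_average_of_fourier (x : ∀ N : ℕ, Fin (N + 1) → AddCircle (2 * Real.pi))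
    [Fact (0 < 2 * Real.pi)]
    (h : ∀ k : ℤ, k ≠ 0 →
      Tendsto (fun N : ℕ => (∑ i, fourier k (x N i)) / (N + 1 : ℂ)) atTop (𝓝 0))
    (f : C(AddCircle (2 * Real.pi), ℂ)) :
    Tendsto (fun N : ℕ => (∑ i, f (x N i)) / (N + 1 : ℂ)) atTop
      (𝓝 (∫ t, f t ∂AddCircle.haarAddCircle)) := by
  have hN : ∀ N : ℕ, (N + 1 : ℂ) ≠ 0 := fun N => by exact_mod_cast Nat.succ_ne_zero N
  have hint : ∀ g : C(AddCircle (2 * Real.pi), ℂ), Integrable g AddCircle.haarAddCircle := fun g =>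
    g.continuous.integrable_of_hasCompactSupport (HasCompactSupport.of_compactSpace g)
  have hspan : ∀ g ∈ Submodule.span ℂ (Set.range (@fourier (2 * Real.pi))),
      Tendsto (fun N : ℕ => (∑ i, g (x N i)) / (N + 1 : ℂ)) atTop
        (𝓝 (∫ t, g t ∂AddCircle.haarAddCircle)) := by
    intro g hg
    induction hg using Submodule.span_induction with
    | mem g hg =>
      obtain ⟨k, rfl⟩ := hg
      by_cases hk : k = 0
      · subst hk
        simp [div_self (hN _)]
      · have h1 : ∫ t, fourier k t ∂(AddCircle.haarAddCircle (T := 2 * Real.pi)) = 0 := by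
          have h2 := congrFun (fourierCoeff_fourier (T := 2 * Real.pi) k) 0
          simpa [fourierCoeff, Pi.single_apply, Ne.symm hk] using h2
        rw [h1]
        exact h k hk
    | zero => simp
    | add g₁ g₂ _ _ ih₁ ih₂ =>
      have h1 := ih₁.add ih₂
      rw [← integral_add (hint g₁) (hint g₂)] at h1
      refine h1.congr fun N => ?_
      simp [Finset.sum_add_distrib, add_div]
    | smul c g _ ih =>
      have h1 := ih.const_mul c
      rw [← integral_const_mul] at h1
      refine h1.congr fun N => ?_
      change _ = (∑ i, c * g (x N i)) / (N + 1 : ℂ)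
      rw [← Finset.mul_sum, mul_div_assoc]
  have hf : f ∈ closure (Submodule.span ℂ (Set.range (@fourier (2 * Real.pi))) : Set _) := by
    rw [← Submodule.topologicalClosure_coe, span_fourier_closure_eq_top]
    trivial
  rw [Metric.tendsto_atTop]
  intro ε hε
  obtain ⟨g, hg, hfg⟩ := Metric.mem_closure_iff.mp hf (ε / 3) (by positivity)
  have hfg' : ∀ t, ‖f t - g t‖ ≤ ε / 3 := fun t => by
    rw [← dist_eq_norm]
    exact (ContinuousMap.dist_apply_le_dist t).trans hfg.le
  obtain ⟨m, hm⟩ := Metric.tendsto_atTop.mp (hspan g hg) (ε / 3) (by positivity)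
  refine ⟨m, fun N hmN => ?_⟩
  have h1 : dist ((∑ i, f (x N i)) / (N + 1 : ℂ)) ((∑ i, g (x N i)) / (N + 1 : ℂ)) ≤ ε / 3 := by
    have hpos : (0 : ℝ) < N + 1 := by positivity
    have hnorm : ‖(N + 1 : ℂ)‖ = N + 1 := by
      rw [← Nat.cast_succ, Complex.norm_natCast, Nat.cast_succ]
    rw [dist_eq_norm, ← sub_div, ← Finset.sum_sub_distrib, norm_div, hnorm, div_le_iff₀ hpos]
    refine (norm_sum_le_of_le _ fun i _ => hfg' (x N i)).trans ?_
    simp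
    linarith
  have h2 : dist (∫ t, g t ∂AddCircle.haarAddCircle) (∫ t, f t ∂AddCircle.haarAddCircle) ≤
      ε / 3 := by
    rw [dist_comm, dist_eq_norm, ← integral_sub (hint f) (hint g)]
    refine (norm_integral_le_of_norm_le_const (Eventually.of_forall hfg')).trans ?_
    simp
  calc _ ≤ _ := dist_triangle4 _ ((∑ i, g (x N i)) / (N + 1 : ℂ))
        (∫ t, g t ∂AddCircle.haarAddCircle) _
    _ < ε / 3 + ε / 3 + ε / 3 := by
        have := hm N hmN
        linarith
    _ = ε := by ring

open MeasureTheory in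
/-- The empirical measure of finitely many points. -/
def empirical {X : Type*} [MeasurableSpace X] {N : ℕ} (x : Fin (N + 1) → X) :
    ProbabilityMeasure X :=
  ⟨((N + 1 : ℕ) : ENNReal)⁻¹ • ∑ i, Measure.dirac (x i), ⟨by
    simp only [Measure.smul_apply, Measure.coe_finsetSum, Finset.sum_apply, measure_univ,
      Finset.sum_const, Finset.card_univ, Fintype.card_fin, smul_eq_mul, nsmul_eq_mul, mul_one]
    exact ENNReal.inv_mul_cancel (by simp) (by simp)⟩⟩

open MeasureTheory in
open Classical in
/-- Angles that satisfy Weyl's criterion are equidistributed with respect to sets with null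
boundary, by the portmanteau theorem. -/
lemma tendsto_card_of_fourier (x : ∀ N : ℕ, Fin (N + 1) → AddCircle (2 * Real.pi))
    [Fact (0 < 2 * Real.pi)]
    (h : ∀ k : ℤ, k ≠ 0 →
      Tendsto (fun N : ℕ => (∑ i, fourier k (x N i)) / (N + 1 : ℂ)) atTop (𝓝 0))
    {E : Set (AddCircle (2 * Real.pi))} (hE : MeasurableSet E)
    (hfr : AddCircle.haarAddCircle (frontier E) = 0) :
    Tendsto (fun N : ℕ => ((Finset.univ.filter fun i => x N i ∈ E).card : ℝ) / (N + 1 : ℝ)) atTop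
      (𝓝 (AddCircle.haarAddCircle.real E)) := by
  set μ : ProbabilityMeasure (AddCircle (2 * Real.pi)) :=
    ⟨AddCircle.haarAddCircle, inferInstance⟩ with hμ
  have hweak : Tendsto (fun N => empirical (x N)) atTop (𝓝 μ) := by
    rw [ProbabilityMeasure.tendsto_iff_forall_integral_tendsto]
    intro f
    have h1 := tendsto_average_of_fourier x h ⟨fun t => (f t : ℂ), by fun_prop⟩
    simp only [ContinuousMap.coe_mk] at h1
    rw [integral_complex_ofReal] at h1
    have h2 := (Complex.continuous_re.tendsto _).comp h1
    rw [Complex.ofReal_re] at h2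
    refine h2.congr fun N => ?_
    have h3 : ∫ t, f t ∂(empirical (x N) : Measure (AddCircle (2 * Real.pi))) =
        (∑ i, f (x N i)) / (N + 1) := by
      change ∫ t, f t ∂(((N + 1 : ℕ) : ENNReal)⁻¹ • ∑ i, Measure.dirac (x N i)) = _
      rw [integral_smul_measure, integral_finsetSum_measure fun i _ => integrable_dirac (by simp)]
      simp [integral_dirac, div_eq_inv_mul, ENNReal.toReal_add]
    rw [h3, Function.comp]
    have h4 : (∑ i, (f (x N i) : ℂ)) / (N + 1 : ℂ) = (((∑ i, f (x N i)) / (N + 1) : ℝ) : ℂ) := by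
      push_cast
      rfl
    rw [h4, Complex.ofReal_re]
  have h5 := ProbabilityMeasure.tendsto_measure_of_null_frontier_of_tendsto' hweak hfr
  have h6 := (ENNReal.tendsto_toReal (measure_ne_top _ E)).comp h5
  refine h6.congr fun N => ?_
  change ((((N + 1 : ℕ) : ENNReal)⁻¹ • ∑ i, Measure.dirac (x N i)) E).toReal = _
  simp only [Measure.smul_apply, Measure.coe_finsetSum, Finset.sum_apply, smul_eq_mul,
    Measure.dirac_apply' _ hE, Set.indicator_apply, Pi.one_apply, ENNReal.toReal_mul,
    ENNReal.toReal_inv]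
  rw [Finset.sum_boole]
  simp [div_eq_inv_mul, ENNReal.toReal_add]

/-- A number in `(-π, π]` represents a point of an arc exactly if it lies in the interval. -/
lemma coe_mem_arc_iff {θ φ t : ℝ} (hθ : -Real.pi ≤ θ) (hφ : φ ≤ Real.pi) (h₁ : -Real.pi < t)
    (h₂ : t ≤ Real.pi) :
    (t : AddCircle (2 * Real.pi)) ∈
      (fun s : ℝ => (s : AddCircle (2 * Real.pi))) '' Set.Ioc θ φ ↔ t ∈ Set.Ioc θ φ := by
  refine ⟨?_, fun h => ⟨t, h, rfl⟩⟩
  rintro ⟨s, hs, hst⟩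
  have h4 : ((s - t : ℝ) : AddCircle (2 * Real.pi)) = 0 := by
    rw [AddCircle.coe_sub]
    exact sub_eq_zero.mpr hst
  obtain ⟨n, hn⟩ := (AddCircle.coe_eq_zero_iff _).mp h4
  rw [zsmul_eq_mul] at hn
  obtain ⟨h5, h6⟩ := hs
  have hpi := Real.pi_pos
  have h7 : n < 1 := by
    by_contra! hc
    have : (1 : ℝ) ≤ n := by exact_mod_cast hc
    nlinarith
  have h8 : -1 < n := by
    by_contra! hc
    have : (n : ℝ) ≤ -1 := by exact_mod_cast hc
    nlinarith
  have h9 : n = 0 := by omega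
  rw [h9, Int.cast_zero, zero_mul] at hn
  have h10 : s = t := by linarith
  exact h10 ▸ ⟨h5, h6⟩

open MeasureTheory in
/-- An arc of the circle has normalized length equal to the normalized difference of its
end points, and its boundary is a null set. -/
lemma haarAddCircle_arc [Fact (0 < 2 * Real.pi)] {θ φ : ℝ} (hθ : -Real.pi ≤ θ) (hθφ : θ < φ)
    (hφ : φ ≤ Real.pi) :
    MeasurableSet ((fun t : ℝ => (t : AddCircle (2 * Real.pi))) '' Set.Ioc θ φ) ∧
      AddCircle.haarAddCircle
        (frontier ((fun t : ℝ => (t : AddCircle (2 * Real.pi))) '' Set.Ioc θ φ)) = 0 ∧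
      AddCircle.haarAddCircle.real
        ((fun t : ℝ => (t : AddCircle (2 * Real.pi))) '' Set.Ioc θ φ) =
          (φ - θ) / (2 * Real.pi) := by
  set q : ℝ → AddCircle (2 * Real.pi) := fun t => (t : AddCircle (2 * Real.pi)) with hq
  have hpi := Real.pi_pos
  have hcont : Continuous q := AddCircle.continuous_mk' _
  have hopen : IsOpen (q '' Set.Ioo θ φ) := QuotientAddGroup.isOpenMap_coe _ isOpen_Ioo
  have hclosed : IsClosed (q '' Set.Icc θ φ) := (isCompact_Icc.image hcont).isClosed
  have hsub₁ : q '' Set.Ioo θ φ ⊆ q '' Set.Ioc θ φ := Set.image_mono Set.Ioo_subset_Ioc_self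
  have hsub₂ : q '' Set.Ioc θ φ ⊆ q '' Set.Icc θ φ := Set.image_mono Set.Ioc_subset_Icc_self
  have hvol : (volume : Measure (AddCircle (2 * Real.pi))) =
      ENNReal.ofReal (2 * Real.pi) • AddCircle.haarAddCircle :=
    AddCircle.volume_eq_smul_haarAddCircle
  have hT : ENNReal.ofReal (2 * Real.pi) ≠ 0 := by
    simpa using hpi
  have hpoint : ∀ y : AddCircle (2 * Real.pi), AddCircle.haarAddCircle {y} = 0 := by
    intro y
    have h1 := AddCircle.volume_closedBall (2 * Real.pi) (x := y) 0
    rw [Metric.closedBall_zero, mul_zero, min_eq_right (by positivity), ENNReal.ofReal_zero, hvol,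
      Measure.smul_apply, smul_eq_mul, mul_eq_zero] at h1
    exact h1.resolve_left hT
  have hmeas : MeasurableSet (q '' Set.Ioc θ φ) := by
    rw [← Set.Ioo_union_right hθφ, Set.image_union, Set.image_singleton]
    exact hopen.measurableSet.union (measurableSet_singleton _)
  refine ⟨hmeas, ?_, ?_⟩
  · have h1 : frontier (q '' Set.Ioc θ φ) ⊆ {q θ} ∪ {q φ} := by
      intro y hy
      obtain ⟨t, ht, rfl⟩ := hclosed.closure_subset_iff.mpr hsub₂ hy.1
      have h2 : q t ∉ q '' Set.Ioo θ φ := fun h => hy.2 (interior_maximal hsub₁ hopen h)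
      rcases ht.1.eq_or_lt with h3 | h3
      · exact Or.inl (by rw [h3]; rfl)
      rcases ht.2.eq_or_lt with h4 | h4
      · exact Or.inr (by rw [h4]; rfl)
      · exact absurd ⟨t, ⟨h3, h4⟩, rfl⟩ h2
    exact measure_mono_null h1 (measure_union_null (hpoint _) (hpoint _))
  · have h1 := (AddCircle.measurePreserving_mk (2 * Real.pi) (-Real.pi)).measure_preimage
      hmeas.nullMeasurableSet
    have h2 : (QuotientAddGroup.mk ⁻¹' (q '' Set.Ioc θ φ)) ∩
        Set.Ioc (-Real.pi) (-Real.pi + 2 * Real.pi) = Set.Ioc θ φ := by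
      ext t
      rw [show -Real.pi + 2 * Real.pi = Real.pi by ring]
      constructor
      · rintro ⟨h3, h4, h5⟩
        exact (coe_mem_arc_iff hθ hφ h4 h5).mp h3
      · intro h3
        exact ⟨⟨t, h3, rfl⟩, hθ.trans_lt h3.1, h3.2.trans hφ⟩
    rw [Measure.restrict_apply (hcont.measurable hmeas), h2, Real.volume_Ioc, hvol,
      Measure.smul_apply, smul_eq_mul] at h1
    have h3 := congrArg ENNReal.toReal h1
    rw [ENNReal.toReal_mul, ENNReal.toReal_ofReal (by linarith),
      ENNReal.toReal_ofReal (by linarith)] at h3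
    rw [Measure.real, h3]
    field_simp

/-! ### Zeros of partial sums of power series -/

lemma exists_fin_map_eq {α : Type*} (s : Multiset α) {n : ℕ} (h : s.card = n) :
    ∃ z : Fin n → α, s = Finset.univ.val.map z := by
  induction s using Quotient.inductionOn with
  | _ l =>
    have hl : l.length = n := h
    subst hl
    refine ⟨l.get, ?_⟩
    rw [Fin.univ_val_map, List.ofFn_get]
    rfl

/-- The zeros of a polynomial with positive coefficients, as a family indexed by `Fin N`, satisfy
the bound from Schur's inequality on every circle of radius `r`. -/
lemma exists_roots_family {c : ℕ → ℝ} (hc : ∀ n, 0 < c n) (N : ℕ) {r : ℝ} (hr : 0 < r) :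
    ∃ z : Fin N → ℂ,
      (∑ n ∈ Finset.range (N + 1), C (c n : ℂ) * X ^ n : ℂ[X]).roots = Finset.univ.val.map z ∧
      (∀ i, z i ≠ 0) ∧
      ∀ u : ℂ, ‖u‖ = 1 → ∏ i, ‖u - z i / ‖z i‖‖ ≤
        Real.exp (Real.log (∑ n ∈ Finset.range (N + 1), c n * r ^ n) -
          (Real.log (c 0 * r ^ 0) + Real.log (c N * r ^ N)) / 2) := by
  set P : ℂ[X] := ∑ n ∈ Finset.range (N + 1), C (c n : ℂ) * X ^ n with hP
  have hcoeff : ∀ n, n ≤ N → P.coeff n = c n := fun n hn => by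
    simp [hP, coeff_X_pow, Nat.lt_succ_of_le hn]
  have hcN : (c N : ℂ) ≠ 0 := by exact_mod_cast (hc N).ne'
  have hdeg : P.natDegree = N := by
    refine natDegree_eq_of_le_of_coeff_ne_zero ?_ (by rwa [hcoeff N le_rfl])
    refine natDegree_sum_le_of_forall_le _ _ fun n hn => ?_
    exact (natDegree_C_mul_X_pow_le _ _).trans (Nat.lt_succ_iff.mp (Finset.mem_range.mp hn))
  have hlead : P.leadingCoeff = c N := by rw [leadingCoeff, hdeg, hcoeff N le_rfl]
  have hsplit : P.Splits := IsAlgClosed.splits P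
  have hcard : P.roots.card = N := by rw [← hsplit.natDegree_eq_card_roots, hdeg]
  obtain ⟨z, hz⟩ := exists_fin_map_eq P.roots hcard
  have heval : ∀ w : ℂ, P.eval w = c N * ∏ i, (w - z i) := fun w => by
    have h1 := hsplit.eq_prod_roots
    rw [h1, hz, hlead, eval_mul, eval_C, eval_multiset_prod, Multiset.map_map, Multiset.map_map]
    simp only [Function.comp_def, eval_sub, eval_X, eval_C]
    rfl
  have h0 : P.eval 0 = c 0 := by rw [← coeff_zero_eq_eval_zero, hcoeff 0 (Nat.zero_le N)]
  have hprod : c N * ∏ i, ‖z i‖ = c 0 := by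
    have h1 := congrArg norm ((heval 0).symm.trans h0)
    simpa [norm_prod, abs_of_pos (hc _)] using h1
  have hz0 : ∀ i, z i ≠ 0 := fun i hi => by
    rw [Finset.prod_eq_zero (Finset.mem_univ i) (by rw [hi, norm_zero]), mul_zero] at hprod
    exact (hc 0).ne hprod
  refine ⟨z, hz, hz0, fun u hu => ?_⟩
  have hS : c N * ∏ i, ‖r * u - z i‖ ≤ ∑ n ∈ Finset.range (N + 1), c n * r ^ n := by
    have h1 : c N * ∏ i, ‖r * u - z i‖ = ‖P.eval (r * u)‖ := by
      rw [heval, norm_mul, norm_prod, Complex.norm_real, Real.norm_of_nonneg (hc N).le]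
    rw [h1, hP, eval_finsetSum]
    refine norm_sum_le_of_le _ fun n _ => ?_
    simp [hu, abs_of_pos (hc n), abs_of_pos hr]
  rw [pow_zero, mul_one]
  exact prod_norm_sub_le z hz0 (hc 0) (hc N) hr hprod hu hS

lemma fourier_coe_arg (k : ℤ) {z : ℂ} (hz : z ≠ 0) :
    fourier k (z.arg : AddCircle (2 * Real.pi)) = (z / ‖z‖) ^ k := by
  have h1 : z / ‖z‖ = Complex.exp (z.arg * Complex.I) := by
    have h2 : (‖z‖ : ℂ) ≠ 0 := by exact_mod_cast norm_ne_zero_iff.mpr hz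
    rw [div_eq_iff h2, mul_comm, Complex.norm_mul_exp_arg_mul_I]
  rw [h1, fourier_coe_apply, ← Complex.exp_int_mul]
  congr 1
  have h3 : (Real.pi : ℂ) ≠ 0 := by exact_mod_cast Real.pi_ne_zero
  push_cast
  field_simp

open Classical in
/-- The arguments of the zeros of the partial sums of a power series are equidistributed if the
coefficients are positive and their `n`-th roots converge to a positive limit. -/
theorem tendsto_angularCount {c : ℕ → ℝ} (hc : ∀ n, 0 < c n) {l : ℝ}
    (hl : Tendsto (fun n : ℕ => Real.log (c n) / n) atTop (𝓝 l)) {θ φ : ℝ}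
    (hθ : -Real.pi ≤ θ) (hθφ : θ < φ) (hφ : φ ≤ Real.pi) :
    Tendsto (fun N : ℕ => (1 / (N : ℝ)) *
        (angularCount (∑ n ∈ Finset.range (N + 1), C (c n : ℂ) * X ^ n) θ φ : ℝ))
      atTop (𝓝 ((φ - θ) / (2 * Real.pi))) := by
  have : Fact (0 < 2 * Real.pi) := ⟨by positivity⟩
  set r := Real.exp (-l)
  have hr : 0 < r := Real.exp_pos _
  have hlim : Tendsto (fun n : ℕ => Real.log (c n * r ^ n) / n) atTop (𝓝 0) := by
    have h1 := hl.sub_const l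
    rw [sub_self] at h1
    refine h1.congr' ?_
    filter_upwards [eventually_ne_atTop 0] with n hn
    have hn : (n : ℝ) ≠ 0 := by exact_mod_cast hn
    rw [Real.log_mul (hc n).ne' (by positivity), Real.log_pow, Real.log_exp]
    field_simp
    ring
  -- The coefficients rescaled by `r` grow subexponentially, which makes Schur's bound `exp (o(N))`.
  have hh := tendsto_log_sum_div (fun n => mul_pos (hc n) (pow_pos hr n)) hlim
  choose z hroots hz0 hbound using fun N => exists_roots_family hc N hr
  have hζ : ∀ N i, ‖z N i / ‖z N i‖‖ = 1 := fun N i => by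
    rw [norm_div, Complex.norm_real, norm_norm, div_self (norm_ne_zero_iff.mpr (hz0 N i))]
  -- The power sums with positive exponents are `o(N)`; the others are their complex conjugates.
  have hweyl : ∀ k : ℕ, 0 < k → Tendsto (fun N : ℕ =>
      (∑ i, (z (N + 1) i / ‖z (N + 1) i‖) ^ k) / (N + 1 : ℂ)) atTop (𝓝 0) := by
    intro k hk
    have h1 := ((hh.comp (tendsto_add_atTop_nat 1)).const_mul (2 * k : ℝ))
    rw [mul_zero] at h1
    refine squeeze_zero_norm (fun N => ?_) h1
    have h2 := norm_sum_pow_le (fun i => z (N + 1) i / ‖z (N + 1) i‖) (hζ (N + 1))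
      (lt_max_of_lt_right one_pos) (fun u hu => (hbound (N + 1) u hu).trans
        (Real.exp_le_exp.mpr (le_max_left _ 1))) hk
    have h3 : ‖(N + 1 : ℂ)‖ = ((N + 1 : ℕ) : ℝ) := by
      rw [← Nat.cast_succ, Complex.norm_natCast]
    rw [norm_div, h3, Function.comp, ← mul_div_assoc, mul_assoc]
    gcongr
  have hfourier : ∀ k : ℤ, k ≠ 0 → Tendsto (fun N : ℕ =>
      (∑ i, fourier k ((z (N + 1) i).arg : AddCircle (2 * Real.pi))) / (N + 1 : ℂ))
      atTop (𝓝 0) := by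
    have hpos : ∀ k : ℕ, 0 < k → Tendsto (fun N : ℕ =>
        (∑ i, fourier (k : ℤ) ((z (N + 1) i).arg : AddCircle (2 * Real.pi))) / (N + 1 : ℂ))
        atTop (𝓝 0) := fun k hk => by
      refine (hweyl k hk).congr fun N => ?_
      simp only [fourier_coe_arg _ (hz0 _ _), zpow_natCast]
    intro k hk
    obtain ⟨m, rfl | rfl⟩ := k.eq_nat_or_neg
    · exact hpos m (by omega)
    · have h1 := ((Complex.continuous_conj.tendsto 0).comp (hpos m (by omega)))
      rw [map_zero] at h1
      refine h1.congr fun N => ?_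
      simp only [Function.comp, map_div₀, map_sum, fourier_neg, map_add, map_natCast, map_one]
  obtain ⟨hmeas, hfr, hval⟩ := haarAddCircle_arc hθ hθφ hφ
  have h1 := tendsto_card_of_fourier
    (fun N i => ((z (N + 1) i).arg : AddCircle (2 * Real.pi))) hfourier hmeas hfr
  rw [hval] at h1
  -- Index `N + 1` throughout, as there is no empirical measure of the empty family of zeros.
  rw [← tendsto_add_atTop_iff_nat 1]
  refine h1.congr fun N => ?_
  have h2 : angularCount (∑ n ∈ Finset.range (N + 1 + 1), C (c n : ℂ) * X ^ n) θ φ =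
      (Finset.univ.filter fun i => ((z (N + 1) i).arg : AddCircle (2 * Real.pi)) ∈
        (fun t : ℝ => (t : AddCircle (2 * Real.pi))) '' Set.Ioc θ φ).card := by
    unfold angularCount
    rw [hroots (N + 1), Multiset.countP_map, ← Finset.filter_val, Finset.card_val]
    congr 1
    ext i
    simp only [Finset.mem_filter, Finset.mem_univ, true_and]
    exact (coe_mem_arc_iff hθ hφ (Complex.neg_pi_lt_arg _) (Complex.arg_le_pi _)).symm
  rw [h2, one_div, ← div_eq_inv_mul]
  push_cast
  rfl

end AdsorbingWalk

end

theorem theorem3p5 (d : ℕ) (a : ℝ) (ha : 0 < a) (θ φ : ℝ)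
    (hθ : -Real.pi ≤ θ) (hθφ : θ < φ) (hφ : φ ≤ Real.pi) :
    Tendsto
      (fun N : ℕ =>
        (1 / (N : ℝ)) * (AdsorbingWalk.angularCount (AdsorbingWalk.partialGF d N a) θ φ : ℝ))
      atTop (𝓝 ((φ - θ) / (2 * Real.pi))) := by
  obtain ⟨hpos, l, hl⟩ := AdsorbingWalk.exists_tendsto_log_partitionFunction d ha
  exact AdsorbingWalk.tendsto_angularCount hpos hl hθ hθφ hφ
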